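/- **Setting.** Let $\mathcal A=\{1,\dots,A\}$ with $A\ge 1$ be a set of actions and $\mathcal D=\{1,\dots,D\}$ a set of features, where feature $i$ takes values in a finite set $\mathcal X_i$; let $\mathcal X=\prod_{i}\mathcal X_i$ and let $\mathcal P(\mathcal D)$ be the set of subsets of $\mathcal D$ (observation sets). A partial state vector $\psi$ assigns to each feature $i$ an element of $\mathcal X_i$ or the symbol N/A; its domain $\mathscr D(\psi)$ is the set of $i$ with $\psi[i]\ne$ N/A. Let $\Psi^+(\mathcal I)$ be the set of partial state vectors with domain $\mathcal I$, $\Psi$ the set of all partial state vectors, and $\Psi_{tot}=\sum_{\mathcal I\subseteq\mathcal D}|\Psi^+(\mathcal I)|$. Write $\phi\sim\psi$ if $\psi[i]=\phi[i]$ for all $i\in\mathscr D(\psi)$, and $\psi\preceq\psi'$ if $\psi$ and $\psi'$ are consistent with a common $\phi\in\mathcal X$ and $\mathscr D(\psi)\subseteq\mathscr D(\psi')$. In each round $t=1,\dots,T$ ($T\ge1$) the agent chooses, on the basis of the past (and possibly of independent randomness to break ties), an observation set $\mathcal I_t$ and an action selection strategy $h_t:\Psi\to\mathcal A$. A state vector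 $\phi_t$ is drawn, independently of the past, from a fixed law on $\mathcal X$. The agent sees the $\psi_t\in\Psi^+(\mathcal I_t)$ with $\phi_t\sim\psi_t$, plays $a_t=h_t(\psi_t)$, pays costs $c_t[i]\in[0,1]$ for $i\in\mathcal I_t$, and receives a reward $r_t\in[0,1]$. The costs have conditional mean $\bar c_t[i]$ given the past, and the reward has conditional mean $\bar r_t(a_t,\phi_t)$ given the past and $\phi_t$, where $\bar r_t:\mathcal A\times\mathcal X\to[0,1]$. Let $\Upsilon_T$ be the number of times before $T$ at which some mean reward or mean cost changes. Let $p(\psi)=\mathbb P[\Phi\sim\psi]$ and $\bar r_t(a,\psi)=\mathbb E[\bar r_t(a,\Phi)\mid\Phi\sim\psi]$, where $\Phi$ has the law of the state vector. A policy is a pair $\pi=(\mathcal I,h)$ with $h:\Psi^+(\mathcal I)\to\mathcal A$; its expected gain is $\rho_t^\pi=\sum_{\psi\in\Psi^+(\mathcal I)}p(\psi)\bar r_t(h(\psi),\psi)-\sum_{i\in\mathcal I}\bar c_t[i]$, and $\rho_t^*=\max_\pi\rho_t^\pi$. The regret is $\mathcal R_T=\sum_{t=1}^T(\rho_t^*-\rho_t^{\pi_t})$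 with $\pi_t=(\mathcal I_t,h_t|_{\Psi^+(\mathcal I_t)})$. **Algorithm NCC-UCRL2** with integer window $w\ge1$ and $\delta>0$. Put $\mathcal T_t(a,\psi;w)=\{t-w<\tau<t: a_\tau=a,\psi_\tau=\psi\}$, $\mathcal T_t(i;w)=\{t-w<\tau<t: i\in\mathcal I_\tau\}$, $\mathcal T_t(\mathcal I)=\{\tau<t:\mathcal I\subseteq\mathcal I_\tau\}$ and, for $\psi\in\Psi^+(\mathcal I)$, $\mathcal T_t(\mathcal I,\psi)=\{\tau<t:\mathcal I\subseteq\mathcal I_\tau,\ \psi\preceq\psi_\tau\}$. Let $N_t(a,\psi;w)$, $N_t(i;w)$, $N_t(\mathcal I)$ be the maximum of $1$ and the cardinality of $\mathcal T_t(a,\psi;w)$, $\mathcal T_t(i;w)$, $\mathcal T_t(\mathcal I)$, respectively. Let $$\hat r_t(a,\psi)=\frac{\sum_{\tau\in\mathcal T_t(a,\psi;w)}r_\tau}{N_t(a,\psi;w)},\qquad \hat c_t[i]=\frac{\sum_{\tau\in\mathcal T_t(i;w)}c_\tau[i]}{N_t(i;w)},\qquad \hat p_t(\psi)=\frac{|\mathcal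 T_t(\mathscr D(\psi),\psi)|}{N_t(\mathscr D(\psi))},$$ $$\tilde r_t(a,\psi)=\hat r_t(a,\psi)+\min\Big\{1,\sqrt{\tfrac{\log(TA\Psi_{tot}w/\delta)}{N_t(a,\psi;w)}}\Big\},\qquad \tilde c_t[i]=\hat c_t[i]-\min\Big\{1,\sqrt{\tfrac{2\log(TDw/\delta)}{N_t(i;w)}}\Big\},$$ $$C_t(\mathcal I)=\min\Big\{1,\sqrt{\tfrac{2\Psi_{tot}\log(2T|\mathcal P(\mathcal D)|/\delta)}{N_t(\mathcal I)}}\Big\}.$$ Let $\hat V_t(\mathcal I)$ be the maximum of $\sum_{\psi\in\Psi^+(\mathcal I)}q(\psi)\max_a\tilde r_t(a,\psi)-\sum_{i\in\mathcal I}\tilde c_t[i]$ over all probability vectors $q$ on $\Psi^+(\mathcal I)$ with $\sum_{\psi\in\Psi^+(\mathcal I)}|q(\psi)-\hat p_t(\psi)|\le C_t(\mathcal I)$. In round $t$ the algorithm chooses $\mathcal I_t\in\arg\max_{\mathcal I}\hat V_t(\mathcal I)$ and $h_t(\psi)\in\arg\max_a\tilde r_t(a,\psi)$ for every $\psi$,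 with ties broken arbitrarily. **Theorem.** There is a universal constant $K>0$ such that in every stationary environment ($\Upsilon_T=0$), for all $T\ge1$ and $\delta>0$, the following holds (terms with a factor $D$ are $0$ if $D=0$; only $\delta<1/3$ is of interest). 1. For every integer $w\ge1$, the regret of NCC-UCRL2 with window $w$ satisfies, with probability at least $1-3\delta$, $$\mathcal R_T\le K\Bigg(T\Big(\sqrt{\tfrac{A\Psi_{tot}\log(TA\Psi_{tot}w/\delta)}{w}}+D\sqrt{\tfrac{\log(TDw/\delta)}{w}}\Big)+\sqrt{T\log(1/\delta)}\Big(\sqrt{A\Psi_{tot}\log(TA\Psi_{tot}w/\delta)}+D\sqrt{\log(TDw/\delta)}\Big)+\sqrt{T|\mathcal P(\mathcal D)|\Psi_{tot}\log(T|\mathcal P(\mathcal D)|/\delta)}\Bigg).$$ 2. With window $w=T$, with probability at least $1-3\delta$, $$\mathcal R_T\le K\Bigg(\big(1+\sqrt{\log(1/\delta)}\big)\Big(\sqrt{TA\Psi_{tot}\log(TA\Psi_{tot}/\delta)}+D\sqrt{T\log(TD/\delta)}\Big)+\sqrt{T|\mathcal P(\mathcal D)|\Psi_{tot}\log(T|\mathcal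 P(\mathcal D)|/\delta)}\Bigg),$$ that is, a bound of order $\tilde O(\sqrt T)$. -/

import Mathlib

open MeasureTheory ProbabilityTheory

noncomputable section

namespace NCC

/-! ### States, partial states, observation sets

Actions are `Fin A`, features are `Fin D`, and feature `i` takes values in the finite type `X i`.
Rounds are numbered `0, …, T - 1`. -/

/-- A full state vector. -/
abbrev StateVec {D : ℕ} (X : Fin D → Type*) := (i : Fin D) → X i

/-- A partial state vector; `none` stands for a missing entry (N/A). -/
abbrev PartialState {D : ℕ} (X : Fin D → Type*) := (i : Fin D) → Option (X i)

section Partial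

variable {D : ℕ} {X : Fin D → Type*}

/-- The domain set of a partial state vector. -/
def dom (ψ : PartialState X) : Finset (Fin D) := Finset.univ.filter fun i => (ψ i).isSome

/-- The set `Ψ⁺(I)` of partial state vectors whose domain set is `I`. -/
abbrev PartialOn (X : Fin D → Type*) (I : Finset (Fin D)) := {ψ : PartialState X // dom ψ = I}

/-- `φ ∼ ψ`: every entry of `ψ` that is present agrees with `φ`. -/
def Consistent (φ : StateVec X) (ψ : PartialState X) : Prop :=
  ∀ i ∈ dom ψ, ψ i = some (φ i)

/-- `ψ ⪯ ψ'`: both are consistent with a common state vector and `dom ψ ⊆ dom ψ'`. -/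
def Substate (ψ ψ' : PartialState X) : Prop :=
  (∃ φ : StateVec X, Consistent φ ψ ∧ Consistent φ ψ') ∧ dom ψ ⊆ dom ψ'

/-- What is seen of the state vector `φ` when the observation set is `I`. -/
def observe (I : Finset (Fin D)) (φ : StateVec X) : PartialState X :=
  fun i => if i ∈ I then some (φ i) else none

/-- `Ψ_tot`, the sum of `|Ψ⁺(I)|` over all observation sets `I`. -/
def psiTot (X : Fin D → Type*) [∀ i, Fintype (X i)] : ℕ :=
  ∑ I : Finset (Fin D), Fintype.card (PartialOn X I)

end Partial

/-- `|𝒫(𝒟)|`, the number of observation sets. -/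
def numObs (D : ℕ) : ℕ := Fintype.card (Finset (Fin D))

/-! ### The environment, policies and gains -/

/-- The parameters of the environment, all unknown to the agent: a fixed law of the state vector,
and mean rewards and mean costs, which may depend on the round. -/
structure Environment (A : ℕ) {D : ℕ} (X : Fin D → Type*) where
  stateLaw : PMF (StateVec X)
  meanReward : ℕ → Fin A → StateVec X → ℝ
  meanCost : ℕ → Fin D → ℝ
  meanReward_mem : ∀ t a φ, meanReward t a φ ∈ Set.Icc (0 : ℝ) 1

/-- A policy: an observation set `I` and a map `Ψ⁺(I) → 𝒜`. -/
structure Policy (A : ℕ) {D : ℕ} (X : Fin D → Type*) where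
  obs : Finset (Fin D)
  strat : PartialOn X obs → Fin A

namespace Environment

variable {A D : ℕ} {X : Fin D → Type*} [∀ i, Fintype (X i)] (env : Environment A X)

/-- `Υ_T`: the number of consecutive pairs of rounds before the horizon `T` between which some mean
reward or mean cost changes. -/
def numChanges {A D : ℕ} {X : Fin D → Type*} (env : Environment A X) (T : ℕ) : ℕ :=
  {t : ℕ | t + 1 < T ∧ (env.meanReward (t + 1) ≠ env.meanReward t ∨
    env.meanCost (t + 1) ≠ env.meanCost t)}.ncard

open Classical in
/-- `p(ψ)`, the probability that the random state vector is consistent with `ψ`. -/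
def prob (ψ : PartialState X) : ℝ :=
  ∑ φ : StateVec X with Consistent φ ψ, (env.stateLaw φ).toReal

open Classical in
/-- The expected reward of `a` in round `t` conditional on the state vector being consistent
with `ψ`. (It is `0` if `p(ψ) = 0`; it is then multiplied by `p(ψ)` wherever it is used.) -/
def partialReward (t : ℕ) (a : Fin A) (ψ : PartialState X) : ℝ :=
  (∑ φ : StateVec X with Consistent φ ψ, (env.stateLaw φ).toReal * env.meanReward t a φ)
    / env.prob ψ

/-- The expected gain of the policy `π` in round `t`. -/
def gain (t : ℕ) (π : Policy A X) : ℝ :=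
  ∑ ψ : PartialOn X π.obs, env.prob ψ.1 * env.partialReward t (π.strat ψ) ψ.1
    - ∑ i ∈ π.obs, env.meanCost t i

/-- The gain of an optimal policy in round `t` (a maximum over finitely many policies). -/
def optGain (t : ℕ) : ℝ := ⨆ π : Policy A X, env.gain t π

end Environment

/-! ### The statistics used by the algorithm -/

/-- A record of play. In round `t`, the algorithm below uses only the entries of earlier rounds, and
only the costs of features that were observed. -/
structure Record (A : ℕ) {D : ℕ} (X : Fin D → Type*) where
  obs : ℕ → Finset (Fin D)
  pstate : ℕ → PartialState X
  act : ℕ → Fin A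
  reward : ℕ → ℝ
  cost : ℕ → Fin D → ℝ

namespace Record

variable {A D : ℕ} {X : Fin D → Type*} (H : Record A X)

open Classical in
/-- `𝒯_t(a, ψ; w)`: the rounds `t - w < τ < t` in which `a` was played upon seeing `ψ`. -/
def timesAct (w t : ℕ) (a : Fin A) (ψ : PartialState X) : Finset ℕ :=
  (Finset.range t).filter fun τ => t < τ + w ∧ H.act τ = a ∧ H.pstate τ = ψ

/-- `𝒯_t(i; w)`: the rounds `t - w < τ < t` in which feature `i` was observed. -/
def timesFeature (w t : ℕ) (i : Fin D) : Finset ℕ :=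
  (Finset.range t).filter fun τ => t < τ + w ∧ i ∈ H.obs τ

/-- `𝒯_t(I)`: the rounds `τ < t` in which all features of `I` were observed. -/
def timesObs (t : ℕ) (I : Finset (Fin D)) : Finset ℕ :=
  (Finset.range t).filter fun τ => I ⊆ H.obs τ

open Classical in
/-- `𝒯_t(dom ψ, ψ)`: the rounds of `𝒯_t(dom ψ)` in which the values in `ψ` were seen. -/
def timesPartial (t : ℕ) (ψ : PartialState X) : Finset ℕ :=
  (Finset.range t).filter fun τ => dom ψ ⊆ H.obs τ ∧ Substate ψ (H.pstate τ)

/-- `N_t(a, ψ; w)`. -/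
def numAct (w t : ℕ) (a : Fin A) (ψ : PartialState X) : ℕ := max 1 (H.timesAct w t a ψ).card

/-- `N_t(i; w)`. -/
def numFeature (w t : ℕ) (i : Fin D) : ℕ := max 1 (H.timesFeature w t i).card

/-- `N_t(I)`. -/
def numObsSet (t : ℕ) (I : Finset (Fin D)) : ℕ := max 1 (H.timesObs t I).card

/-- Windowed empirical mean reward. -/
def rewardHat (w t : ℕ) (a : Fin A) (ψ : PartialState X) : ℝ :=
  (∑ τ ∈ H.timesAct w t a ψ, H.reward τ) / H.numAct w t a ψ

/-- Windowed empirical mean cost. -/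
def costHat (w t : ℕ) (i : Fin D) : ℝ :=
  (∑ τ ∈ H.timesFeature w t i, H.cost τ i) / H.numFeature w t i

/-- Empirical probability of a partial state vector. -/
def probHat (t : ℕ) (ψ : PartialState X) : ℝ :=
  ((H.timesPartial t ψ).card : ℝ) / H.numObsSet t (dom ψ)

variable [∀ i, Fintype (X i)]

/-- Confidence radius `C_t(a, ψ; w)`. -/
def radAct (T w : ℕ) (δ : ℝ) (t : ℕ) (a : Fin A) (ψ : PartialState X) : ℝ :=
  min 1 √(Real.log ((T : ℝ) * A * psiTot X * w / δ) / H.numAct w t a ψ)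

/-- Confidence radius `C_t(i; w)`. -/
def radFeature (T w : ℕ) (δ : ℝ) (t : ℕ) (i : Fin D) : ℝ :=
  min 1 √(2 * Real.log ((T : ℝ) * D * w / δ) / H.numFeature w t i)

/-- Confidence radius `C_t(I)`. -/
def radObs (T : ℕ) (δ : ℝ) (t : ℕ) (I : Finset (Fin D)) : ℝ :=
  min 1 √(2 * psiTot X * Real.log (2 * (T : ℝ) * numObs D / δ) / H.numObsSet t I)

/-- Optimistic reward estimate. -/
def rewardUp (T w : ℕ) (δ : ℝ) (t : ℕ) (a : Fin A) (ψ : PartialState X) : ℝ :=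
  H.rewardHat w t a ψ + H.radAct T w δ t a ψ

/-- Optimistic (that is, lower) cost estimate. -/
def costLow (T w : ℕ) (δ : ℝ) (t : ℕ) (i : Fin D) : ℝ :=
  H.costHat w t i - H.radFeature T w δ t i

/-- The plausible laws of the partial state vector with domain `I`: points of the simplex at
`L¹`-distance at most `C_t(I)` from the empirical probabilities. -/
def plausible (T : ℕ) (δ : ℝ) (t : ℕ) (I : Finset (Fin D)) : Set (PartialOn X I → ℝ) :=
  {q | q ∈ stdSimplex ℝ (PartialOn X I) ∧
    ∑ ψ : PartialOn X I, |q ψ - H.probHat t ψ.1| ≤ H.radObs T δ t I}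

/-- The optimistic value of the observation set `I` in round `t`: the maximum of the optimistic
gain over the plausible laws. -/
def valueUp (T w : ℕ) (δ : ℝ) (t : ℕ) (I : Finset (Fin D)) : ℝ :=
  sSup ((fun q : PartialOn X I → ℝ =>
      ∑ ψ : PartialOn X I, q ψ * (⨆ a : Fin A, H.rewardUp T w δ t a ψ.1)
        - ∑ i ∈ I, H.costLow T w δ t i) '' H.plausible T δ t I)

end Record

/-! ### The interaction of agent and environment -/

/-- The random processes of an interaction on a sample space `Ω`: state vectors, costs, rewards, and
the observation sets and action selection strategies chosen by the agent. -/
structure Play (Ω : Type*) (A : ℕ) {D : ℕ} (X : Fin D → Type*) where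
  state : ℕ → Ω → StateVec X
  cost : ℕ → Ω → Fin D → ℝ
  reward : ℕ → Ω → ℝ
  obs : ℕ → Ω → Finset (Fin D)
  strat : ℕ → Ω → PartialState X → Fin A

namespace Play

variable {Ω : Type*} {A D : ℕ} {X : Fin D → Type*} (P : Play Ω A X)

/-- The partial state vector seen in round `t`. -/
def pstate (t : ℕ) (ω : Ω) : PartialState X := observe (P.obs t ω) (P.state t ω)

/-- The action played in round `t`. -/
def act (t : ℕ) (ω : Ω) : Fin A := P.strat t ω (P.pstate t ω)

/-- The policy used in round `t`. -/
def policy (t : ℕ) (ω : Ω) : Policy A X := ⟨P.obs t ω, fun ψ => P.strat t ω ψ.1⟩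

/-- The record of play along the sample point `ω`. -/
def record (ω : Ω) : Record A X where
  obs t := P.obs t ω
  pstate t := P.pstate t ω
  act t := P.act t ω
  reward t := P.reward t ω
  cost t := P.cost t ω

/-- The regret over the rounds `0, …, T - 1`. -/
def regret [∀ i, Fintype (X i)] (env : Environment A X) (T : ℕ) (ω : Ω) : ℝ :=
  ∑ t ∈ Finset.range T, (env.optGain t - env.gain t (P.policy t ω))

/-- The interaction protocol with environment `env` over `T` rounds. Here `𝓕 t` is the information
that exists before round `t` (possibly more than the agent sees, and possibly with independent
randomness for breaking ties). The agent's choices for round `t` are made on the basis of `𝓕 t`, the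
state vector of round `t` is drawn afresh, and costs and rewards lie in `[0,1]` with the mean that
`env` prescribes, given the past, respectively given the past and the current state vector. -/
structure IsInteraction [mΩ : MeasurableSpace Ω] (μ : Measure Ω) (𝓕 : Filtration ℕ mΩ)
    (env : Environment A X) (T : ℕ) : Prop where
  obs_meas : ∀ t < T, ∀ I, MeasurableSet[𝓕 t] {ω | P.obs t ω = I}
  strat_meas : ∀ t < T, ∀ ψ a, MeasurableSet[𝓕 t] {ω | P.strat t ω ψ = a}
  state_meas : ∀ t < T, ∀ φ, MeasurableSet[𝓕 (t + 1)] {ω | P.state t ω = φ}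
  cost_meas : ∀ t < T, ∀ i, Measurable[𝓕 (t + 1)] fun ω => P.cost t ω i
  reward_meas : ∀ t < T, Measurable[𝓕 (t + 1)] (P.reward t)
  cost_mem : ∀ t < T, ∀ ω i, P.cost t ω i ∈ Set.Icc (0 : ℝ) 1
  reward_mem : ∀ t < T, ∀ ω, P.reward t ω ∈ Set.Icc (0 : ℝ) 1
  state_law : ∀ t < T, ∀ φ, μ {ω | P.state t ω = φ} = env.stateLaw φ
  state_indep : ∀ t < T, Indep (MeasurableSpace.comap (P.state t) ⊤) (𝓕 t) μ
  cost_mean : ∀ t < T, ∀ i, μ[fun ω => P.cost t ω i | 𝓕 t] =ᵐ[μ] fun _ => env.meanCost t i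
  reward_mean : ∀ t < T,
    μ[P.reward t | 𝓕 t ⊔ MeasurableSpace.comap (P.state t) ⊤] =ᵐ[μ]
      fun ω => env.meanReward t (P.act t ω) (P.state t ω)

/-- The agent runs NCC-UCRL2 with horizon `T`, window `w` and confidence parameter `δ`: in every
round the observation set maximizes the optimistic value, and the action selection strategy
maximizes the optimistic reward estimate (with arbitrary choices among maximizers). -/
def FollowsNCCUCRL2 [∀ i, Fintype (X i)] (T w : ℕ) (δ : ℝ) : Prop :=
  ∀ ω, ∀ t < T,
    (∀ I, (P.record ω).valueUp T w δ t I ≤ (P.record ω).valueUp T w δ t (P.obs t ω)) ∧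
    (∀ ψ a, (P.record ω).rewardUp T w δ t a ψ ≤
      (P.record ω).rewardUp T w δ t (P.strat t ω ψ) ψ)

end Play

end NCC

end

/-! The argument is optimism under uncertainty. On an event of probability at least `1 - 3 * δ`, the
optimistic value of the chosen observation set dominates the gain of every competitor that matters.
The regret of a round is then at most the gap between that value and the gain of the policy played.
This gap is bounded by confidence radii (`Accurate.valueUp_le`), and these are summed by a
pigeonhole argument.

Concentration rests on one inequality, `Sampling.measure_le`. Samples in `[0,1]` are taken at random
rounds, with a prescribed mean given the past and the fact that a sample is taken. An exponential
supermartingale, stopped after the first `n` samples, gives Hoeffding's bound for all times at which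
the sample size is `n`, without a union over time. It is applied to rewards and costs (window by
window, hence with a union over rounds), to empirical frequencies of sets of partial states, and to
the radii met along the play.

The delicate point is the truncation of `C_t(I)` at `1`. Two probability vectors can be at
`L¹`-distance `2`, so when the radius is `1` the true law need not be plausible and optimism is not
automatic. It is rescued by shifting mass (`exists_optimistic`). Only states of optimistic value
below `1` can be overweighted harmfully. In such a state every action has a radius below `1`, so
each has been played more than `L = log (T A Ψ_tot w / δ)` times. Hence a set `B` of these states
forces at least `A * L * B.card` observations. For `A ≥ 2`, Hoeffding's bound for a deviation `1 /
2` is then at most `exp (-L)` to the power `B.card`, which can be summed over all `B`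
(`measure_heavy_deviation`). An excess of at most `1 / 2` is repaired by moving mass at `L¹`-cost at
most `1`. For `A = 1` the rewards do not depend on the policy, so observing nothing is optimal, and
for the empty observation set there is only one partial state.

The gap contains the reward radius averaged over the state law, whereas pigeonhole controls the
radius of the state actually seen. The martingale bound `measure_policy_deviation` passes from one
to the other and produces the term `√(T log (1/δ))`. Sums of radii are taken over blocks of at most
`w` rounds, inside which windowed counts dominate counts since the start of the block. This gives `T
/ √w + √T` (`sum_range_le_of_blocks`). The case `w = T` follows by simplifying the logarithms, and
for `δ ≥ 1 / 3` there is nothing to prove. -/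

noncomputable section

namespace NCC

/-! ### Bounded measurable functions -/

/-- `Y` is bounded and measurable with respect to the σ-algebra `m`. -/
def BddMeas {Ω : Type*} (m : MeasurableSpace Ω) (Y : Ω → ℝ) : Prop :=
  Measurable[m] Y ∧ ∃ C : ℝ, ∀ ω, |Y ω| ≤ C

namespace BddMeas

variable {Ω : Type*} {m m' : MeasurableSpace Ω} {Y Z : Ω → ℝ}

lemma of_mem_Icc {a b : ℝ} (h : Measurable[m] Y) (hb : ∀ ω, Y ω ∈ Set.Icc a b) : BddMeas m Y :=
  ⟨h, max |a| |b|, fun ω => abs_le_max_abs_abs (hb ω).1 (hb ω).2⟩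

lemma const (c : ℝ) : BddMeas m (fun _ : Ω => c) := ⟨measurable_const, |c|, fun _ => le_rfl⟩

lemma mul (hY : BddMeas m Y) (hZ : BddMeas m Z) : BddMeas m (fun ω => Y ω * Z ω) := by
  obtain ⟨hY, C, hC⟩ := hY
  obtain ⟨hZ, C', hC'⟩ := hZ
  refine ⟨hY.mul hZ, C * C', fun ω => ?_⟩
  rw [abs_mul]
  exact mul_le_mul (hC ω) (hC' ω) (abs_nonneg _) ((abs_nonneg _).trans (hC ω))

lemma add (hY : BddMeas m Y) (hZ : BddMeas m Z) : BddMeas m (fun ω => Y ω + Z ω) := by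
  obtain ⟨hY, C, hC⟩ := hY
  obtain ⟨hZ, C', hC'⟩ := hZ
  exact ⟨hY.add hZ, C + C', fun ω => (abs_add_le _ _).trans (add_le_add (hC ω) (hC' ω))⟩

lemma neg (hY : BddMeas m Y) : BddMeas m (fun ω => - Y ω) := by
  obtain ⟨hY, C, hC⟩ := hY
  exact ⟨hY.neg, C, fun ω => by rw [abs_neg]; exact hC ω⟩

lemma sub (hY : BddMeas m Y) (hZ : BddMeas m Z) : BddMeas m (fun ω => Y ω - Z ω) := by
  simpa [sub_eq_add_neg] using hY.add hZ.neg

lemma sum {ι : Type*} (s : Finset ι) {F : ι → Ω → ℝ} (h : ∀ i ∈ s, BddMeas m (F i)) :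
    BddMeas m (fun ω => ∑ i ∈ s, F i ω) := by
  classical
  induction s using Finset.induction_on with
  | empty => simpa using const 0
  | insert i s hi ih =>
    simp only [Finset.sum_insert hi]
    exact (h i (by simp)).add (ih fun j hj => h j (by simp [hj]))

lemma exp (hY : BddMeas m Y) : BddMeas m (fun ω => Real.exp (Y ω)) := by
  obtain ⟨hY, C, hC⟩ := hY
  refine ⟨Real.measurable_exp.comp hY, Real.exp C, fun ω => ?_⟩
  rw [Real.abs_exp]
  exact Real.exp_le_exp.2 ((le_abs_self _).trans (hC ω))

lemma mono (hY : BddMeas m Y) (h : m ≤ m') : BddMeas m' Y := ⟨hY.1.mono h le_rfl, hY.2⟩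

lemma integrable (μ : Measure[m'] Ω) [IsFiniteMeasure μ] (hY : BddMeas m Y) (h : m ≤ m') :
    Integrable Y μ := by
  obtain ⟨hY, C, hC⟩ := hY
  exact Integrable.of_bound (hY.mono h le_rfl).aestronglyMeasurable C (ae_of_all _ hC)

lemma ite {p : Ω → Prop} [DecidablePred p] (h : MeasurableSet[m] {ω | p ω}) :
    BddMeas m (fun ω => if p ω then (1 : ℝ) else 0) :=
  of_mem_Icc (a := 0) (b := 1) (Measurable.ite h measurable_const measurable_const)
    fun ω => by split_ifs <;> simp

end BddMeas

/-! ### A Hoeffding bound at random sample sizes -/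

/-- Hoeffding's lemma for a Bernoulli variable. -/
lemma bernoulli_mgf_le {m : ℝ} (hm : m ∈ Set.Icc (0 : ℝ) 1) (l : ℝ) :
    m * Real.exp (l * (1 - m)) + (1 - m) * Real.exp (l * (0 - m)) ≤ Real.exp (l ^ 2 / 8) := by
  obtain ⟨h0, h1⟩ := hm
  let ν : Measure ℝ := ENNReal.ofReal m • Measure.dirac 1 + ENNReal.ofReal (1 - m) • Measure.dirac 0
  have hν : IsProbabilityMeasure ν := ⟨by
    simp only [ν, Measure.add_apply, Measure.smul_apply, measure_univ, smul_eq_mul, mul_one]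
    rw [← ENNReal.ofReal_add h0 (by linarith)]; simp⟩
  have hint (f : ℝ → ℝ) : ∫ x, f x ∂ν = m * f 1 + (1 - m) * f 0 := by
    have hd (a c : ℝ) : Integrable f (ENNReal.ofReal c • Measure.dirac a) :=
      (integrable_dirac (by simp)).smul_measure (by simp)
    rw [integral_add_measure (hd _ _) (hd _ _)]
    simp [integral_smul_measure, h0, h1]
  have hmem : ∀ᵐ x ∂ν, id x ∈ Set.Icc (0 : ℝ) 1 := by
    simp only [ν, ae_add_measure_iff]
    constructor <;> refine Measure.ae_smul_measure ?_ _ <;> simp [ae_dirac_eq]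
  have := (hasSubgaussianMGF_of_mem_Icc (μ := ν) (X := id) aemeasurable_id hmem).mgf_le l
  rw [mgf, hint, hint] at this
  convert this using 2
  · simp
  · simp
  · norm_num
    ring

section Concentration

variable {Ω : Type*} {mΩ : MeasurableSpace Ω} {μ : Measure Ω}
  {𝓕 : Filtration ℕ mΩ} {T : ℕ} {e x m : ℕ → Ω → ℝ}

/-- Samples `x τ ∈ [0,1]`, taken in the rounds with `e τ = 1`, whose mean given the past and the
fact that a sample is taken is `m τ`. -/
structure Sampling (μ : Measure Ω) (𝓕 : Filtration ℕ mΩ) (T : ℕ) (e x m : ℕ → Ω → ℝ) : Prop where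
  ind : ∀ τ ω, e τ ω = 0 ∨ e τ ω = 1
  ind_meas : ∀ τ < T, Measurable[𝓕 (τ + 1)] (e τ)
  val_meas : ∀ τ < T, Measurable[𝓕 (τ + 1)] (x τ)
  mean_meas : ∀ τ < T, Measurable[𝓕 τ] (m τ)
  val_mem : ∀ τ < T, ∀ ω, x τ ω ∈ Set.Icc (0 : ℝ) 1
  mean_mem : ∀ τ < T, ∀ ω, m τ ω ∈ Set.Icc (0 : ℝ) 1
  mean_eq : ∀ τ < T, ∀ Y, BddMeas (𝓕 τ) Y → ∫ ω, Y ω * (e τ ω * x τ ω) ∂μ =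
    ∫ ω, Y ω * (e τ ω * m τ ω) ∂μ

namespace Sampling

lemma ind_mem (h : Sampling μ 𝓕 T e x m) (τ : ℕ) (ω : Ω) : e τ ω ∈ Set.Icc (0 : ℝ) 1 := by
  rcases h.ind τ ω with h | h <;> simp [h]

lemma ind_bdd (h : Sampling μ 𝓕 T e x m) {τ : ℕ} (hτ : τ < T) : BddMeas (𝓕 (τ + 1)) (e τ) :=
  .of_mem_Icc (h.ind_meas τ hτ) (h.ind_mem τ)

lemma val_bdd (h : Sampling μ 𝓕 T e x m) {τ : ℕ} (hτ : τ < T) : BddMeas (𝓕 (τ + 1)) (x τ) :=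
  .of_mem_Icc (h.val_meas τ hτ) (h.val_mem τ hτ)

lemma mean_bdd (h : Sampling μ 𝓕 T e x m) {τ : ℕ} (hτ : τ < T) : BddMeas (𝓕 τ) (m τ) :=
  .of_mem_Icc (h.mean_meas τ hτ) (h.mean_mem τ hτ)

lemma count_bdd (h : Sampling μ 𝓕 T e x m) {t : ℕ} (ht : t ≤ T) :
    BddMeas (𝓕 t) (fun ω => ∑ s ∈ Finset.range t, e s ω) :=
  .sum _ fun s hs => by
    have hs := Finset.mem_range.1 hs
    exact (h.ind_bdd (hs.trans_le ht)).mono (𝓕.mono hs)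

/-- The count is monotone. Up to a time at which it equals `n`, no sample has been discarded, and
every later one is. The final sum of the truncated process therefore equals the sum at each such
time, which makes the Hoeffding bound uniform in `t`. -/
lemma sum_truncate (h : Sampling μ 𝓕 T e x m) {n t : ℕ} (ht : t ≤ T) (ω : Ω)
    (hn : ∑ τ ∈ Finset.range t, e τ ω = n) (f : ℕ → ℝ) :
    ∑ τ ∈ Finset.range T, (e τ ω * if ∑ s ∈ Finset.range τ, e s ω < n then 1 else 0) * f τ =
      ∑ τ ∈ Finset.range t, e τ ω * f τ := by
  have hmono : Monotone fun t => ∑ τ ∈ Finset.range t, e τ ω := monotone_nat_of_le_succ fun t => by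
    rw [Finset.sum_range_succ]; linarith [(h.ind_mem t ω).1]
  rw [← Finset.sum_subset (Finset.range_subset_range.2 ht)]
  · refine Finset.sum_congr rfl fun τ hτ => ?_
    rcases h.ind τ ω with h0 | h1
    · simp [h0]
    · have : ∑ s ∈ Finset.range (τ + 1), e s ω ≤ ∑ s ∈ Finset.range t, e s ω :=
        hmono (Finset.mem_range.1 hτ)
      rw [Finset.sum_range_succ, h1, hn] at this
      rw [if_pos (by linarith)]; simp
  · intro τ _ hτ
    have : ∑ s ∈ Finset.range t, e s ω ≤ ∑ s ∈ Finset.range τ, e s ω :=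
      hmono (not_lt.1 fun h => hτ (Finset.mem_range.2 h))
    rw [if_neg (by linarith)]; simp

open Classical in
/-- The first `n` samples. -/
lemma truncate (h : Sampling μ 𝓕 T e x m) (n : ℕ) :
    Sampling μ 𝓕 T
      (fun τ ω => e τ ω * if ∑ s ∈ Finset.range τ, e s ω < n then 1 else 0) x m := by
  have hI (τ : ℕ) (hτ : τ < T) : BddMeas (𝓕 τ)
      (fun ω => if ∑ s ∈ Finset.range τ, e s ω < n then (1 : ℝ) else 0) :=
    .ite ((h.count_bdd hτ.le).1 measurableSet_Iio)
  refine ⟨fun τ ω => ?_, fun τ hτ => ?_, h.val_meas, h.mean_meas, h.val_mem, h.mean_mem,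
    fun τ hτ Y hY => ?_⟩
  · rcases h.ind τ ω with h | h <;> simp only [h] <;> split_ifs <;> simp
  · exact ((h.ind_bdd hτ).mul ((hI τ hτ).mono (𝓕.mono (Nat.le_succ τ)))).1
  · convert h.mean_eq τ hτ _ (hY.mul (hI τ hτ)) using 3 <;> ring

variable [IsProbabilityMeasure μ]

/-- The samples `1 - x`. -/
lemma compl (h : Sampling μ 𝓕 T e x m) :
    Sampling μ 𝓕 T e (fun τ ω => 1 - x τ ω) (fun τ ω => 1 - m τ ω) where
  ind := h.ind
  ind_meas := h.ind_meas
  val_meas τ hτ := (h.val_meas τ hτ).const_sub 1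
  mean_meas τ hτ := (h.mean_meas τ hτ).const_sub 1
  val_mem τ hτ ω := by have := h.val_mem τ hτ ω; constructor <;> linarith [this.1, this.2]
  mean_mem τ hτ ω := by have := h.mean_mem τ hτ ω; constructor <;> linarith [this.1, this.2]
  mean_eq τ hτ Y hY := by
    have hle := 𝓕.le (τ + 1)
    have hle' : 𝓕 τ ≤ 𝓕 (τ + 1) := 𝓕.mono (Nat.le_succ τ)
    have hY' := hY.mono hle'
    simp only [mul_sub, mul_one]
    rw [integral_sub ((hY'.mul (h.ind_bdd hτ)).integrable μ hle)
        ((hY'.mul ((h.ind_bdd hτ).mul (h.val_bdd hτ))).integrable μ hle),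
      integral_sub ((hY'.mul (h.ind_bdd hτ)).integrable μ hle)
        ((hY'.mul ((h.ind_bdd hτ).mul ((h.mean_bdd hτ).mono hle'))).integrable μ hle),
      h.mean_eq τ hτ Y hY]

/-- The supermartingale step. The indicator `e τ` need not be known before round `τ`, since for
rewards it depends on the state drawn in that round. By convexity the exponential is at most its
chord, which is affine in `x τ`. The chord can be integrated using the mean condition alone, and
Hoeffding's lemma for a Bernoulli variable of mean `m τ` finishes. -/
lemma integral_exp_step (h : Sampling μ 𝓕 T e x m) {τ : ℕ} (hτ : τ < T) (l : ℝ) {Y : Ω → ℝ}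
    (hY : BddMeas (𝓕 τ) Y) (hY0 : ∀ ω, 0 ≤ Y ω) :
    ∫ ω, Y ω * Real.exp (e τ ω * (l * (x τ ω - m τ ω) - l ^ 2 / 8)) ∂μ ≤ ∫ ω, Y ω ∂μ := by
  have hle := 𝓕.le (τ + 1)
  have hle' : 𝓕 τ ≤ 𝓕 (τ + 1) := 𝓕.mono (Nat.le_succ τ)
  have hY' := hY.mono hle'
  have hm := h.mean_bdd hτ
  have he := h.ind_bdd hτ
  have hx := h.val_bdd hτ
  have hm' := hm.mono hle'
  let a : Ω → ℝ := fun ω => Real.exp (l * (1 - m τ ω) - l ^ 2 / 8)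
  let b : Ω → ℝ := fun ω => Real.exp (l * (0 - m τ ω) - l ^ 2 / 8)
  have ha : BddMeas (𝓕 τ) a := (((BddMeas.const l).mul ((BddMeas.const 1).sub hm)).sub (.const _)).exp
  have hb : BddMeas (𝓕 τ) b := (((BddMeas.const l).mul ((BddMeas.const 0).sub hm)).sub (.const _)).exp
  have ha' := ha.mono hle'
  have hb' := hb.mono hle'
  let Z : Ω → ℝ := fun ω => Y ω * (a ω - b ω)
  have hZ : BddMeas (𝓕 τ) Z := hY.mul (ha.sub hb)
  have hZ' := hZ.mono hle'
  let R : Ω → ℝ := fun ω => Y ω * (1 - e τ ω) + Y ω * (e τ ω * b ω)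
  have hR : BddMeas (𝓕 (τ + 1)) R := (hY'.mul ((BddMeas.const 1).sub he)).add (hY'.mul (he.mul hb'))
  have hconv (ω : Ω) (y : ℝ) (hy : y ∈ Set.Icc (0 : ℝ) 1) :
      Real.exp (l * (y - m τ ω) - l ^ 2 / 8) ≤ y * a ω + (1 - y) * b ω := by
    have := convexOn_exp.2 (Set.mem_univ (l * (1 - m τ ω) - l ^ 2 / 8))
      (Set.mem_univ (l * (0 - m τ ω) - l ^ 2 / 8)) hy.1 (sub_nonneg.2 hy.2) (by ring)
    simp only [smul_eq_mul] at this
    refine le_trans (le_of_eq ?_) this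
    congr 1; ring
  calc ∫ ω, Y ω * Real.exp (e τ ω * (l * (x τ ω - m τ ω) - l ^ 2 / 8)) ∂μ
      ≤ ∫ ω, Z ω * (e τ ω * x τ ω) + R ω ∂μ := by
        refine integral_mono ((hY'.mul (he.mul (((BddMeas.const l).mul (hx.sub hm')).sub
          (.const _))).exp).integrable μ hle)
          (((hZ'.mul (he.mul hx)).add hR).integrable μ hle) fun ω => ?_
        have := mul_le_mul_of_nonneg_left (hconv ω _ (h.val_mem τ hτ ω)) (hY0 ω)
        rcases h.ind τ ω with h0 | h1
        · simp [h0, R]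
        · simp only [h1, R, Z]
          refine le_trans (le_trans (le_of_eq ?_) this) (le_of_eq ?_) <;> ring_nf
    _ = ∫ ω, Z ω * (e τ ω * m τ ω) + R ω ∂μ := by
        rw [integral_add ((hZ'.mul (he.mul hx)).integrable μ hle) (hR.integrable μ hle),
          integral_add ((hZ'.mul (he.mul hm')).integrable μ hle) (hR.integrable μ hle),
          h.mean_eq τ hτ Z hZ]
    _ ≤ ∫ ω, Y ω ∂μ := by
        refine integral_mono (((hZ'.mul (he.mul hm')).add hR).integrable μ hle)
          (hY'.integrable μ hle) fun ω => ?_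
        have hab : m τ ω * a ω + (1 - m τ ω) * b ω ≤ 1 := by
          have := bernoulli_mgf_le (h.mean_mem τ hτ ω) l
          simp only [a, b, Real.exp_sub]
          rw [← mul_div_assoc, ← mul_div_assoc, ← add_div, div_le_one (Real.exp_pos _)]
          exact this
        have := mul_le_mul_of_nonneg_left hab (hY0 ω)
        rcases h.ind τ ω with h0 | h1
        · simp [h0, R]
        · simp only [h1, R, Z]
          nlinarith

lemma integral_exp_le (h : Sampling μ 𝓕 T e x m) (l : ℝ) {t : ℕ} (ht : t ≤ T) :
    BddMeas (𝓕 t) (fun ω => Real.exp (∑ τ ∈ Finset.range t,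
        e τ ω * (l * (x τ ω - m τ ω) - l ^ 2 / 8))) ∧
    ∫ ω, Real.exp (∑ τ ∈ Finset.range t,
        e τ ω * (l * (x τ ω - m τ ω) - l ^ 2 / 8)) ∂μ ≤ 1 := by
  constructor
  · refine (BddMeas.sum _ fun s hs => ?_).exp
    have hs := Finset.mem_range.1 hs
    have hsT := hs.trans_le ht
    exact ((h.ind_bdd hsT).mul (((BddMeas.const l).mul ((h.val_bdd hsT).sub
      ((h.mean_bdd hsT).mono (𝓕.mono (Nat.le_succ s))))).sub (.const _))).mono (𝓕.mono hs)
  · induction t with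
    | zero => simp
    | succ t ih =>
      refine le_trans ?_ (ih (Nat.le_of_succ_le ht))
      simp only [Finset.sum_range_succ, Real.exp_add]
      refine h.integral_exp_step ht l ?_ fun ω => (Real.exp_pos _).le
      refine (BddMeas.sum _ fun s hs => ?_).exp
      have hs := Finset.mem_range.1 hs
      have hsT : s < T := hs.trans ht
      exact ((h.ind_bdd hsT).mul (((BddMeas.const l).mul ((h.val_bdd hsT).sub
        ((h.mean_bdd hsT).mono (𝓕.mono (Nat.le_succ s))))).sub (.const _))).mono (𝓕.mono hs)

/-- Hoeffding's inequality for the first `n` samples, at all times simultaneously. -/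
theorem measure_le (h : Sampling μ 𝓕 T e x m) (n : ℕ) {ε : ℝ} (hε : 0 ≤ ε) :
    μ.real {ω | ∃ t ≤ T, ∑ τ ∈ Finset.range t, e τ ω = n ∧
      n * ε ≤ ∑ τ ∈ Finset.range t, e τ ω * (x τ ω - m τ ω)} ≤ Real.exp (-(2 * n * ε ^ 2)) := by
  -- The exponent `l = 4 * ε` maximizes `l * ε - l ^ 2 / 8`, with value `2 * ε ^ 2`.
  obtain ⟨hb, hi⟩ := (h.truncate n).integral_exp_le (4 * ε) le_rfl
  have hM := mul_meas_ge_le_integral_of_nonneg (μ := μ) (ae_of_all _ fun ω => (Real.exp_pos _).le)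
    (hb.integrable μ (𝓕.le T)) (Real.exp (2 * n * ε ^ 2))
  rw [Real.exp_neg, ← one_div, le_div_iff₀ (Real.exp_pos _), mul_comm]
  refine le_trans (mul_le_mul_of_nonneg_left (measureReal_mono ?_) (Real.exp_pos _).le)
    (hM.trans hi)
  rintro ω ⟨t, ht, hn, hdev⟩
  rw [Set.mem_ofPred_eq]
  rw [h.sum_truncate ht ω hn]
  refine Real.exp_le_exp.2 ?_
  have : ∑ τ ∈ Finset.range t, e τ ω * (4 * ε * (x τ ω - m τ ω) - (4 * ε) ^ 2 / 8) =
      4 * ε * ∑ τ ∈ Finset.range t, e τ ω * (x τ ω - m τ ω) -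
        (∑ τ ∈ Finset.range t, e τ ω) * (2 * ε ^ 2) := by
    rw [Finset.mul_sum, Finset.sum_mul, ← Finset.sum_sub_distrib]
    exact Finset.sum_congr rfl fun τ _ => by ring
  rw [this, hn]
  nlinarith

end Sampling

end Concentration

/-! ### Partial states and their probabilities -/

section States

variable {A D : ℕ} {X : Fin D → Type*}

@[simp] lemma mem_dom {ψ : PartialState X} {i : Fin D} : i ∈ dom ψ ↔ (ψ i).isSome := by
  simp [dom]

@[simp] lemma dom_observe (I : Finset (Fin D)) (φ : StateVec X) : dom (observe I φ) = I := by
  ext i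
  by_cases h : i ∈ I <;> simp [observe, h]

lemma observe_eq_iff {I : Finset (Fin D)} {φ : StateVec X} {ψ : PartialState X} :
    observe I φ = ψ ↔ I = dom ψ ∧ Consistent φ ψ := by
  constructor
  · rintro rfl
    refine ⟨(dom_observe I φ).symm, fun i hi => ?_⟩
    rw [dom_observe] at hi
    simp [observe, hi]
  · rintro ⟨rfl, h⟩
    funext i
    by_cases hi : i ∈ dom ψ
    · rw [h i hi]; simp only [observe, hi, if_true]
    · have : ψ i = none := by simpa using hi
      simp only [observe, hi, if_false, this]

/-- A common completion agrees with `φ` on `I`, hence on the domain of `ψ`. So the rounds counted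
for `ψ` are decided by the state drawn alone once `I` is known to be observed. -/
lemma substate_observe_iff {I : Finset (Fin D)} {φ : StateVec X} {ψ : PartialState X}
    (h : dom ψ ⊆ I) : Substate ψ (observe I φ) ↔ Consistent φ ψ := by
  constructor
  · rintro ⟨⟨φ', h1, h2⟩, -⟩ i hi
    rw [h1 i hi]
    have := h2 i (by rw [dom_observe]; exact h hi)
    simpa [observe, h hi, eq_comm] using this
  · intro h'
    exact ⟨⟨φ, h', (observe_eq_iff.1 rfl).2⟩, by rwa [dom_observe]⟩

lemma consistent_iff_eq {I : Finset (Fin D)} {φ : StateVec X} (ψ : PartialOn X I) :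
    Consistent φ ψ.1 ↔ (⟨observe I φ, dom_observe I φ⟩ : PartialOn X I) = ψ := by
  rw [Subtype.ext_iff, observe_eq_iff, ψ.2]
  simp

variable [∀ i, Fintype (X i)]

/-- Every partial state has exactly one domain. Unions over all pairs of an action and a partial
state therefore cost a factor `A * psiTot X`. -/
lemma psiTot_eq_card : psiTot X = Fintype.card (PartialState X) := by
  classical
  rw [psiTot, ← Fintype.card_sigma]
  exact Fintype.card_congr (Equiv.sigmaFiberEquiv dom)

lemma card_partialOn_le (I : Finset (Fin D)) : Fintype.card (PartialOn X I) ≤ psiTot X :=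
  Finset.single_le_sum (f := fun I => Fintype.card (PartialOn X I)) (fun _ _ => Nat.zero_le _)
    (Finset.mem_univ I)

lemma one_le_psiTot : 1 ≤ psiTot X := by
  rw [psiTot_eq_card]
  exact Fintype.card_pos_iff.2 ⟨fun _ => none⟩

lemma one_le_numObs : 1 ≤ numObs D := Fintype.card_pos

open Classical in
lemma sum_consistent {M : Type*} [AddCommMonoid M] {I : Finset (Fin D)} (φ : StateVec X)
    (f : PartialState X → M) :
    ∑ ψ : PartialOn X I, (if Consistent φ ψ.1 then f ψ.1 else 0) = f (observe I φ) := by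
  simp_rw [consistent_iff_eq]
  rw [Finset.sum_ite_eq]
  simp

namespace Environment

variable (env : Environment A X)

/-- The mean of a function of the state vector. -/
def expect (g : StateVec X → ℝ) : ℝ := ∑ φ, (env.stateLaw φ).toReal * g φ

lemma sum_stateLaw : ∑ φ, (env.stateLaw φ).toReal = 1 := by
  rw [← ENNReal.toReal_sum fun φ _ => env.stateLaw.apply_ne_top φ, ← tsum_fintype (L := .unconditional _),
    env.stateLaw.tsum_coe, ENNReal.toReal_one]

lemma expect_const (c : ℝ) : env.expect (fun _ => c) = c := by
  rw [expect, ← Finset.sum_mul, sum_stateLaw, one_mul]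

lemma expect_mono {g g' : StateVec X → ℝ} (h : ∀ φ, g φ ≤ g' φ) : env.expect g ≤ env.expect g' :=
  Finset.sum_le_sum fun φ _ => mul_le_mul_of_nonneg_left (h φ) ENNReal.toReal_nonneg

lemma expect_sum {ι : Type*} (s : Finset ι) (g : ι → StateVec X → ℝ) :
    env.expect (fun φ => ∑ i ∈ s, g i φ) = ∑ i ∈ s, env.expect (g i) := by
  simp only [expect, Finset.mul_sum]
  exact Finset.sum_comm

lemma expect_mul_const (g : StateVec X → ℝ) (c : ℝ) :
    env.expect (fun φ => g φ * c) = env.expect g * c := by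
  simp [expect, Finset.sum_mul, mul_assoc]

open Classical in
lemma prob_eq (ψ : PartialState X) :
    env.prob ψ = env.expect fun φ => if Consistent φ ψ then 1 else 0 := by
  simp [prob, expect, Finset.sum_filter]

lemma prob_nonneg (ψ : PartialState X) : 0 ≤ env.prob ψ :=
  Finset.sum_nonneg fun _ _ => ENNReal.toReal_nonneg

open Classical in
lemma prob_mul_partialReward (t : ℕ) (a : Fin A) (ψ : PartialState X) :
    env.prob ψ * env.partialReward t a ψ =
      env.expect fun φ => (if Consistent φ ψ then 1 else 0) * env.meanReward t a φ := by
  have : (env.expect fun φ => (if Consistent φ ψ then 1 else 0) * env.meanReward t a φ) =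
      ∑ φ : StateVec X with Consistent φ ψ, (env.stateLaw φ).toReal * env.meanReward t a φ := by
    simp [expect, Finset.sum_filter]
  rw [this, partialReward]
  -- If `p(ψ) = 0`, all states consistent with `ψ` have mass zero, so the default value of the
  -- quotient is harmless.
  by_cases h : env.prob ψ = 0
  · rw [h, zero_mul]
    refine (Finset.sum_eq_zero fun φ hφ => ?_).symm
    rw [prob, Finset.sum_eq_zero_iff_of_nonneg fun _ _ => ENNReal.toReal_nonneg] at h
    rw [h φ hφ, zero_mul]
  · rw [mul_div_cancel₀ _ h]

lemma partialReward_mem (t : ℕ) (a : Fin A) (ψ : PartialState X) :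
    env.partialReward t a ψ ∈ Set.Icc (0 : ℝ) 1 := by
  classical
  constructor
  · exact div_nonneg (Finset.sum_nonneg fun φ _ => mul_nonneg ENNReal.toReal_nonneg
      (env.meanReward_mem t a φ).1) (env.prob_nonneg ψ)
  · refine div_le_one_of_le₀ (Finset.sum_le_sum fun φ _ => ?_) (env.prob_nonneg ψ)
    exact mul_le_of_le_one_right ENNReal.toReal_nonneg (env.meanReward_mem t a φ).2

lemma sum_prob_mul (I : Finset (Fin D)) (f : PartialState X → ℝ) :
    ∑ ψ : PartialOn X I, env.prob ψ.1 * f ψ.1 = env.expect fun φ => f (observe I φ) := by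
  classical
  simp_rw [← sum_consistent (I := I) _ f, expect_sum, prob_eq, ← expect_mul_const, ite_mul, one_mul,
    zero_mul]

lemma sum_prob (I : Finset (Fin D)) : ∑ ψ : PartialOn X I, env.prob ψ.1 = 1 := by
  simpa [expect_const] using env.sum_prob_mul I fun _ => 1

end Environment

end States

/-! ### The sampling processes of an interaction -/

section Interaction

variable {Ω : Type*} {mΩ : MeasurableSpace Ω} {μ : Measure Ω} [IsProbabilityMeasure μ]

lemma integral_mul_of_condExp {m : MeasurableSpace Ω} (hm : m ≤ mΩ) {Y f g : Ω → ℝ}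
    (hY : BddMeas m Y) (hf : Integrable f μ) (h : μ[f | m] =ᵐ[μ] g) :
    ∫ ω, Y ω * f ω ∂μ = ∫ ω, Y ω * g ω ∂μ := by
  have hYf : Integrable (fun ω => Y ω * f ω) μ := by
    obtain ⟨hYm, C, hC⟩ := hY
    exact hf.bdd_mul (hYm.mono hm le_rfl).aestronglyMeasurable (ae_of_all _ hC)
  rw [← integral_condExp hm]
  refine integral_congr_ae ?_
  filter_upwards [condExp_mul_of_stronglyMeasurable_left hY.1.stronglyMeasurable hYf hf, h]
    with ω h1 h2
  rw [← h2]
  exact h1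

namespace Play.IsInteraction

variable {A D : ℕ} {X : Fin D → Type*} [∀ i, Fintype (X i)] {P : Play Ω A X}
  {𝓕 : Filtration ℕ mΩ} {env : Environment A X} {T t : ℕ}

omit [IsProbabilityMeasure μ] in
lemma state_set_meas (hP : P.IsInteraction μ 𝓕 env T) (ht : t < T) (S : Set (StateVec X)) :
    MeasurableSet[𝓕 (t + 1)] {ω | P.state t ω ∈ S} := by
  have : {ω | P.state t ω ∈ S} = ⋃ φ ∈ S, {ω | P.state t ω = φ} := by ext; simp
  rw [this]
  exact MeasurableSet.biUnion S.to_countable fun φ _ => hP.state_meas t ht φ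

omit [IsProbabilityMeasure μ] in
lemma comap_state_le (hP : P.IsInteraction μ 𝓕 env T) (ht : t < T) :
    MeasurableSpace.comap (P.state t) ⊤ ≤ 𝓕 (t + 1) := by
  rintro _ ⟨S, -, rfl⟩
  exact hP.state_set_meas ht S

open Classical in
lemma integral_state_eq (hP : P.IsInteraction μ 𝓕 env T) (ht : t < T) {Y : Ω → ℝ}
    (hY : BddMeas (𝓕 t) Y) (φ : StateVec X) :
    ∫ ω, Y ω * (if P.state t ω = φ then 1 else 0) ∂μ =
      (env.stateLaw φ).toReal * ∫ ω, Y ω ∂μ := by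
  have hle := (hP.comap_state_le ht).trans (𝓕.le _)
  have hb : BddMeas (MeasurableSpace.comap (P.state t) ⊤)
      (fun ω => if P.state t ω = φ then (1 : ℝ) else 0) := .ite (MeasurableSpace.measurableSet_comap.2 ⟨{φ}, trivial, rfl⟩)
  have h := condExp_indep_eq hle (𝓕.le t) hb.1.stronglyMeasurable (hP.state_indep t ht)
  rw [integral_mul_of_condExp (𝓕.le t) hY (hb.integrable μ hle) h, integral_mul_const, mul_comm]
  congr 1
  have hS : MeasurableSet {ω | P.state t ω = φ} := 𝓕.le _ _ (hP.state_meas t ht φ)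
  rw [← hP.state_law t ht φ, ← measureReal_def, ← integral_indicator_one hS]
  exact integral_congr_ae (ae_of_all _ fun ω => by simp [Set.indicator])

/-- The new state is independent of `𝓕 t`, so it can be averaged out while everything known before
the round stays frozen. -/
lemma integral_state (hP : P.IsInteraction μ 𝓕 env T) (ht : t < T) {g : StateVec X → Ω → ℝ}
    (hg : ∀ φ, BddMeas (𝓕 t) (g φ)) :
    ∫ ω, g (P.state t ω) ω ∂μ = ∫ ω, env.expect (fun φ => g φ ω) ∂μ := by
  classical
  have h1 (ω : Ω) : g (P.state t ω) ω = ∑ φ, g φ ω * (if P.state t ω = φ then 1 else 0) := by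
    simp
  have hle := 𝓕.le (t + 1)
  have hle' : 𝓕 t ≤ 𝓕 (t + 1) := 𝓕.mono (Nat.le_succ t)
  simp_rw [h1, Environment.expect]
  rw [integral_finsetSum, integral_finsetSum]
  · exact Finset.sum_congr rfl fun φ _ => by
      rw [hP.integral_state_eq ht (hg φ), integral_const_mul]
  · exact fun φ _ => ((hg φ).integrable μ (𝓕.le t)).const_mul _
  · exact fun φ _ => (((hg φ).mono hle').mul (.ite (hP.state_meas t ht φ))).integrable μ hle

lemma integral_mul_state (hP : P.IsInteraction μ 𝓕 env T) (ht : t < T) {Y : Ω → ℝ}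
    (hY : BddMeas (𝓕 t) Y) (g : StateVec X → ℝ) :
    ∫ ω, Y ω * g (P.state t ω) ∂μ = ∫ ω, Y ω * env.expect g ∂μ := by
  rw [hP.integral_state ht (g := fun φ ω => Y ω * g φ) fun φ => hY.mul (.const _)]
  simp [Environment.expect, Finset.mul_sum, mul_left_comm]

-- The environment does not bound its mean costs. Their range comes from the costs themselves, by
-- taking expectations.
omit [∀ i, Fintype (X i)] in
lemma meanCost_mem (hP : P.IsInteraction μ 𝓕 env T) (ht : t < T) (i : Fin D) :
    env.meanCost t i ∈ Set.Icc (0 : ℝ) 1 := by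
  have hb : BddMeas (𝓕 (t + 1)) (fun ω => P.cost t ω i) :=
    .of_mem_Icc (hP.cost_meas t ht i) fun ω => hP.cost_mem t ht ω i
  have hint := hb.integrable μ (𝓕.le _)
  have h : ∫ ω, P.cost t ω i ∂μ = env.meanCost t i := by
    simpa using integral_mul_of_condExp (𝓕.le t) (.const 1) hint (hP.cost_mean t ht i)
  rw [← h]
  constructor
  · exact integral_nonneg fun ω => (hP.cost_mem t ht ω i).1
  · simpa using integral_mono hint (integrable_const 1) fun ω => (hP.cost_mem t ht ω i).2

omit [IsProbabilityMeasure μ] [∀ i, Fintype (X i)] in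
lemma obs_set_meas (hP : P.IsInteraction μ 𝓕 env T) (ht : t < T) (S : Set (Finset (Fin D))) :
    MeasurableSet[𝓕 t] {ω | P.obs t ω ∈ S} := by
  have : {ω | P.obs t ω ∈ S} = ⋃ I ∈ S, {ω | P.obs t ω = I} := by ext; simp
  rw [this]
  exact MeasurableSet.biUnion S.to_countable fun I _ => hP.obs_meas t ht I

omit [∀ i, Fintype (X i)] in
open Classical in
lemma sampling_cost (hP : P.IsInteraction μ 𝓕 env T)
    (hs : ∀ t < T, env.meanCost t = env.meanCost 0) (W : ℕ → Prop) [DecidablePred W] (i : Fin D) :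
    Sampling μ 𝓕 T (fun τ ω => if W τ ∧ i ∈ P.obs τ ω then 1 else 0)
      (fun τ ω => P.cost τ ω i) (fun _ _ => env.meanCost 0 i) where
  ind τ ω := by split_ifs <;> simp
  ind_meas τ hτ := by
    refine (BddMeas.ite ?_).1.mono (𝓕.mono (Nat.le_succ τ)) le_rfl
    exact (MeasurableSet.const _).inter (hP.obs_set_meas hτ {I | i ∈ I})
  val_meas τ hτ := hP.cost_meas τ hτ i
  mean_meas τ _ := measurable_const
  val_mem τ hτ ω := hP.cost_mem τ hτ ω i
  mean_mem τ hτ ω := hs τ hτ ▸ hP.meanCost_mem hτ i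
  mean_eq τ hτ Y hY := by
    have he : BddMeas (𝓕 τ) (fun ω => if W τ ∧ i ∈ P.obs τ ω then (1 : ℝ) else 0) :=
      .ite ((MeasurableSet.const _).inter (hP.obs_set_meas hτ {I | i ∈ I}))
    have hb : BddMeas (𝓕 (τ + 1)) (fun ω => P.cost τ ω i) :=
      .of_mem_Icc (hP.cost_meas τ hτ i) fun ω => hP.cost_mem τ hτ ω i
    simp_rw [← mul_assoc, ← hs τ hτ]
    exact integral_mul_of_condExp (𝓕.le τ) (hY.mul he) (hb.integrable μ (𝓕.le _))
      (hP.cost_mean τ hτ i)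

-- This separates what the agent decides before the round from the condition on the fresh state, so
-- that independence applies.
omit [∀ i, Fintype (X i)] in
lemma act_pstate_iff (P : Play Ω A X) {τ : ℕ} {ω : Ω} {a : Fin A} {ψ : PartialState X} :
    P.act τ ω = a ∧ P.pstate τ ω = ψ ↔
      (P.obs τ ω = dom ψ ∧ P.strat τ ω ψ = a) ∧ Consistent (P.state τ ω) ψ := by
  have h := observe_eq_iff (I := P.obs τ ω) (φ := P.state τ ω) (ψ := ψ)
  constructor
  · rintro ⟨ha, hψ⟩
    rw [Play.act, hψ] at ha
    exact ⟨⟨(h.1 hψ).1, ha⟩, (h.1 hψ).2⟩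
  · rintro ⟨⟨ho, hs⟩, hc⟩
    have hψ : P.pstate τ ω = ψ := h.2 ⟨ho, hc⟩
    exact ⟨by rw [Play.act, hψ, hs], hψ⟩

omit [IsProbabilityMeasure μ] [∀ i, Fintype (X i)] in
lemma choice_meas (hP : P.IsInteraction μ 𝓕 env T) (ht : t < T) (a : Fin A) (ψ : PartialState X) :
    MeasurableSet[𝓕 t] {ω | P.obs t ω = dom ψ ∧ P.strat t ω ψ = a} :=
  (hP.obs_meas t ht _).inter (hP.strat_meas t ht ψ a)

open Classical in
lemma sampling_reward (hP : P.IsInteraction μ 𝓕 env T)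
    (hs : ∀ t < T, env.meanReward t = env.meanReward 0) (W : ℕ → Prop) [DecidablePred W] (a : Fin A)
    (ψ : PartialState X) :
    Sampling μ 𝓕 T (fun τ ω => if W τ ∧ P.act τ ω = a ∧ P.pstate τ ω = ψ then 1 else 0)
      P.reward (fun _ _ => env.partialReward 0 a ψ) where
  ind τ ω := by split_ifs <;> simp
  ind_meas τ hτ := by
    refine (BddMeas.ite ?_).1
    simp_rw [act_pstate_iff]
    exact (MeasurableSet.const _).inter ((𝓕.mono (Nat.le_succ τ) _ (hP.choice_meas hτ a ψ)).inter
      (hP.state_set_meas hτ {φ | Consistent φ ψ}))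
  val_meas τ hτ := hP.reward_meas τ hτ
  mean_meas τ _ := measurable_const
  val_mem τ hτ ω := hP.reward_mem τ hτ ω
  mean_mem τ hτ ω := env.partialReward_mem 0 a ψ
  mean_eq τ hτ Y hY := by
    let Z : Ω → ℝ := fun ω => Y ω *
      if W τ ∧ P.obs τ ω = dom ψ ∧ P.strat τ ω ψ = a then (1 : ℝ) else 0
    let g : StateVec X → ℝ := fun φ => if Consistent φ ψ then (1 : ℝ) else 0
    have hZ : BddMeas (𝓕 τ) Z := hY.mul (.ite ((MeasurableSet.const _).inter
      (hP.choice_meas hτ a ψ)))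
    have hle := (hP.comap_state_le hτ).trans (𝓕.le _)
    have hg : BddMeas (MeasurableSpace.comap (P.state τ) ⊤) (fun ω => g (P.state τ ω)) :=
      .ite (MeasurableSpace.measurableSet_comap.2 ⟨{φ | Consistent φ ψ}, trivial, rfl⟩)
    have hb : BddMeas (𝓕 (τ + 1)) (P.reward τ) :=
      .of_mem_Icc (hP.reward_meas τ hτ) (hP.reward_mem τ hτ)
    have he (ω : Ω) (c : ℝ) : Y ω * ((if W τ ∧ P.act τ ω = a ∧ P.pstate τ ω = ψ
        then (1 : ℝ) else 0) * c) = Z ω * g (P.state τ ω) * c := by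
      simp only [act_pstate_iff, Z, g]
      by_cases h1 : W τ <;> by_cases h2 : P.obs τ ω = dom ψ <;>
        by_cases h3 : P.strat τ ω ψ = a <;> by_cases h4 : Consistent (P.state τ ω) ψ <;>
        simp [h1, h2, h3, h4]
    simp_rw [he]
    rw [integral_mul_of_condExp (sup_le (𝓕.le τ) hle)
      ((hZ.mono le_sup_left).mul (hg.mono le_sup_right)) (hb.integrable μ (𝓕.le _))
      (hP.reward_mean τ hτ)]
    -- On the sampling event the action is `a`, and off it both sides vanish. The integrand becomes
    -- an `𝓕 τ`-measurable factor times a function of the state.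
    have h1 (ω : Ω) : Z ω * g (P.state τ ω) * env.meanReward τ (P.act τ ω) (P.state τ ω) =
        Z ω * (fun φ => g φ * env.meanReward 0 a φ) (P.state τ ω) := by
      rw [hs τ hτ, mul_assoc]
      by_cases h : (W τ ∧ P.obs τ ω = dom ψ ∧ P.strat τ ω ψ = a) ∧ Consistent (P.state τ ω) ψ
      · rw [((act_pstate_iff P).2 ⟨h.1.2, h.2⟩).1]
      · rw [not_and_or] at h
        rcases h with h | h
        · simp [Z, h]
        · simp [g, h]
    simp_rw [h1, mul_assoc]
    rw [hP.integral_mul_state hτ hZ (fun φ => g φ * env.meanReward 0 a φ),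
      hP.integral_mul_state hτ hZ (fun φ => g φ * env.partialReward 0 a ψ),
      Environment.expect_mul_const, ← env.prob_eq ψ, env.prob_mul_partialReward]

-- Frequencies are sampled for whole sets `B`, since an `L¹`-bound will be read off from its worst
-- set. Exactly one partial state on `I` is consistent with a given state vector, so the samples lie
-- in `[0,1]`.
open Classical in
lemma sampling_partial (hP : P.IsInteraction μ 𝓕 env T) (I : Finset (Fin D))
    (B : Finset (PartialOn X I)) :
    Sampling μ 𝓕 T (fun τ ω => if I ⊆ P.obs τ ω then 1 else 0)
      (fun τ ω => ∑ ψ ∈ B, if Consistent (P.state τ ω) ψ.1 then 1 else 0)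
      (fun _ _ => ∑ ψ ∈ B, env.prob ψ.1) where
  ind τ ω := by split_ifs <;> simp
  ind_meas τ hτ := by
    refine (BddMeas.ite ?_).1.mono (𝓕.mono (Nat.le_succ τ)) le_rfl
    exact hP.obs_set_meas hτ {J | I ⊆ J}
  val_meas τ hτ := (BddMeas.sum _ fun ψ _ =>
    .ite (hP.state_set_meas hτ {φ | Consistent φ ψ.1})).1
  mean_meas τ _ := measurable_const
  val_mem τ hτ ω := by
    refine ⟨Finset.sum_nonneg fun ψ _ => by split_ifs <;> simp, ?_⟩
    refine (Finset.sum_le_univ_sum_of_nonneg fun ψ => by split_ifs <;> simp).trans ?_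
    exact (sum_consistent (P.state τ ω) fun _ => (1 : ℝ)).le
  mean_mem τ hτ ω := by
    refine ⟨Finset.sum_nonneg fun ψ _ => env.prob_nonneg _, ?_⟩
    refine (Finset.sum_le_univ_sum_of_nonneg fun ψ => env.prob_nonneg _).trans ?_
    exact (env.sum_prob I).le
  mean_eq τ hτ Y hY := by
    have he : BddMeas (𝓕 τ) (fun ω => if I ⊆ P.obs τ ω then (1 : ℝ) else 0) :=
      .ite (hP.obs_set_meas hτ {J | I ⊆ J})
    simp_rw [← mul_assoc]
    rw [hP.integral_mul_state hτ (hY.mul he)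
      (fun φ => ∑ ψ ∈ B, if Consistent φ ψ.1 then 1 else 0), Environment.expect_sum]
    simp_rw [← env.prob_eq]

/-- A sample is taken in every round. The function `R` and the policy are known beforehand, and only
the state is random, so the mean given the past is the average over the state law. -/
lemma sampling_policy (hP : P.IsInteraction μ 𝓕 env T) {R : ℕ → Ω → Fin A → PartialState X → ℝ}
    (hR : ∀ τ < T, ∀ a ψ, Measurable[𝓕 τ] fun ω => R τ ω a ψ)
    (hR' : ∀ τ < T, ∀ ω a ψ, R τ ω a ψ ∈ Set.Icc (0 : ℝ) 1) :
    Sampling μ 𝓕 T (fun _ _ => 1) (fun τ ω => R τ ω (P.act τ ω) (P.pstate τ ω))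
      (fun τ ω => ∑ ψ : PartialOn X (P.obs τ ω), env.prob ψ.1 * R τ ω (P.strat τ ω ψ.1) ψ.1) := by
  classical
  have hm (τ : ℕ) (ω : Ω) : (∑ ψ : PartialOn X (P.obs τ ω),
      env.prob ψ.1 * R τ ω (P.strat τ ω ψ.1) ψ.1) = env.expect fun φ =>
        R τ ω (P.strat τ ω (observe (P.obs τ ω) φ)) (observe (P.obs τ ω) φ) :=
    env.sum_prob_mul (P.obs τ ω) fun ψ => R τ ω (P.strat τ ω ψ) ψ
  have hF (τ : ℕ) (hτ : τ < T) (φ : StateVec X) : BddMeas (𝓕 τ) fun ω =>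
      R τ ω (P.strat τ ω (observe (P.obs τ ω) φ)) (observe (P.obs τ ω) φ) := by
    have h (ω : Ω) : R τ ω (P.strat τ ω (observe (P.obs τ ω) φ)) (observe (P.obs τ ω) φ) =
        ∑ I, ∑ a, (if P.obs τ ω = I then 1 else 0) * ((if P.strat τ ω (observe I φ) = a
          then 1 else 0) * R τ ω a (observe I φ)) := by
      simp
    simp_rw [h]
    exact .sum _ fun I _ => .sum _ fun a _ => (BddMeas.ite (hP.obs_meas τ hτ I)).mul
      ((BddMeas.ite (hP.strat_meas τ hτ _ a)).mul
        (.of_mem_Icc (hR τ hτ a _) fun ω => hR' τ hτ ω a _))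
  simp_rw [hm]
  refine ⟨fun _ _ => Or.inr rfl, fun _ _ => measurable_const, fun τ hτ => ?_, fun τ hτ => ?_,
    fun τ hτ ω => hR' τ hτ ω _ _, fun τ hτ ω => ⟨?_, ?_⟩, fun τ hτ Y hY => ?_⟩
  · have h (ω : Ω) : R τ ω (P.act τ ω) (P.pstate τ ω) = ∑ φ,
        (if P.state τ ω = φ then 1 else 0) *
          R τ ω (P.strat τ ω (observe (P.obs τ ω) φ)) (observe (P.obs τ ω) φ) := by
      simp [Play.act, Play.pstate]
    simp_rw [h]
    exact (BddMeas.sum _ fun φ _ => (BddMeas.ite (hP.state_meas τ hτ φ)).mul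
      ((hF τ hτ φ).mono (𝓕.mono (Nat.le_succ τ)))).1
  · exact (BddMeas.sum _ fun φ _ => (BddMeas.const _).mul (hF τ hτ φ)).1
  · rw [← env.expect_const 0]
    exact env.expect_mono fun φ => (hR' τ hτ ω _ _).1
  · rw [← env.expect_const 1]
    exact env.expect_mono fun φ => (hR' τ hτ ω _ _).2
  · simp only [one_mul]
    have := hP.integral_state hτ (g := fun φ ω => Y ω *
      R τ ω (P.strat τ ω (observe (P.obs τ ω) φ)) (observe (P.obs τ ω) φ))
      fun φ => hY.mul (hF τ hτ φ)
    simp only [Play.act, Play.pstate]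
    rw [this]
    simp [Environment.expect, Finset.mul_sum, mul_left_comm]

end Play.IsInteraction

end Interaction

/-! ### Membership in the sets of rounds behind the statistics -/

namespace Record

variable {A D : ℕ} {X : Fin D → Type*} {H : Record A X} {w t τ : ℕ}

@[simp] lemma mem_timesAct {a : Fin A} {ψ : PartialState X} : τ ∈ H.timesAct w t a ψ ↔
    τ < t ∧ t < τ + w ∧ H.act τ = a ∧ H.pstate τ = ψ := by simp [timesAct]

@[simp] lemma mem_timesFeature {i : Fin D} : τ ∈ H.timesFeature w t i ↔
    τ < t ∧ t < τ + w ∧ i ∈ H.obs τ := by simp [timesFeature]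

@[simp] lemma mem_timesObs {I : Finset (Fin D)} : τ ∈ H.timesObs t I ↔ τ < t ∧ I ⊆ H.obs τ := by
  simp [timesObs]

@[simp] lemma mem_timesPartial {ψ : PartialState X} : τ ∈ H.timesPartial t ψ ↔
    τ < t ∧ dom ψ ⊆ H.obs τ ∧ Substate ψ (H.pstate τ) := by simp [timesPartial]

end Record

section RecordOfPlay

variable {Ω : Type*} {A D : ℕ} {X : Fin D → Type*} (P : Play Ω A X) (ω : Ω)

@[simp] lemma Play.record_obs : (P.record ω).obs = fun t => P.obs t ω := rfl
@[simp] lemma Play.record_act : (P.record ω).act = fun t => P.act t ω := rfl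
@[simp] lemma Play.record_pstate : (P.record ω).pstate = fun t => P.pstate t ω := rfl

end RecordOfPlay

/-! ### Probabilities of large deviations -/

section Deviations

variable {Ω : Type*} {mΩ : MeasurableSpace Ω} {μ : Measure Ω}

lemma measureReal_exists_le {ι : Type*} [Fintype ι] (s : Finset ℕ) {p : ℕ → ι → Ω → Prop} {c : ι → ℝ}
    (h : ∀ n ∈ s, ∀ i, μ.real {ω | p n i ω} ≤ c i) :
    μ.real {ω | ∃ n ∈ s, ∃ i, p n i ω} ≤ s.card * ∑ i, c i := by
  have : {ω | ∃ n ∈ s, ∃ i, p n i ω} = ⋃ n ∈ s, ⋃ i, {ω | p n i ω} := by ext; simp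
  rw [this, ← nsmul_eq_mul]
  refine (measureReal_biUnion_finset_le _ _).trans (Finset.sum_le_card_nsmul _ _ _ fun n hn => ?_)
  exact (measureReal_iUnion_fintype_le _).trans (Finset.sum_le_sum fun i _ => h n hn i)

variable [IsProbabilityMeasure μ]

/-- With `ε = √(L / n)` Hoeffding's bound is `exp (-2 L)` for every `n`. The prefactor counts `w`
possible sample sizes and two signs. -/
lemma Sampling.measure_abs_le {𝓕 : Filtration ℕ mΩ} {T : ℕ} {e x m : ℕ → Ω → ℝ}
    (h : Sampling μ 𝓕 T e x m) {t : ℕ} (ht : t ≤ T) (w : ℕ) {L : ℝ} (hL : 0 ≤ L) :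
    μ.real {ω | ∃ n ∈ Finset.Icc 1 w, ∑ τ ∈ Finset.range t, e τ ω = n ∧
      n * √(L / n) ≤ |∑ τ ∈ Finset.range t, e τ ω * (x τ ω - m τ ω)|} ≤
        2 * w * Real.exp (-(2 * L)) := by
  have hn (n : ℕ) (hn : n ∈ Finset.Icc 1 w) : 2 * n * √(L / n) ^ 2 = 2 * L := by
    have : (0 : ℝ) < n := by exact_mod_cast (Finset.mem_Icc.1 hn).1
    rw [Real.sq_sqrt (by positivity)]
    field_simp
  refine (measureReal_mono ?_).trans ((measureReal_exists_le (μ := μ) (ι := Bool) (Finset.Icc 1 w)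
    (p := fun n b ω => ∃ t ≤ T, ∑ τ ∈ Finset.range t, e τ ω = n ∧
      n * √(L / n) ≤ ∑ τ ∈ Finset.range t, e τ ω *
        (bif b then (x τ ω - m τ ω) else ((1 - x τ ω) - (1 - m τ ω))))
    (c := fun _ => Real.exp (-(2 * L))) fun n hn' b => ?_).trans (le_of_eq ?_))
  · rintro ω ⟨n, hn, hc, hd⟩
    refine ⟨n, hn, ?_⟩
    rcases le_abs.1 hd with hd | hd
    · exact ⟨true, t, ht, hc, hd⟩
    · refine ⟨false, t, ht, hc, hd.trans (le_of_eq ?_)⟩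
      rw [← Finset.sum_neg_distrib]
      exact Finset.sum_congr rfl fun τ _ => by simp only [cond_false]; ring
  · rw [← hn n hn']
    cases b
    · exact h.compl.measure_le n (Real.sqrt_nonneg _)
    · exact h.measure_le n (Real.sqrt_nonneg _)
  · simp; ring

/-- The condition `1 ≤ L` makes the radius of an empty sample equal to `1`, which no mean in `[0,1]`
violates. For the same reason a violated radius is never the truncated one. -/
lemma deviation_of_mean {s : Finset ℕ} {f : ℕ → ℝ} {m L : ℝ} (hf : ∀ τ ∈ s, f τ ∈ Set.Icc (0 : ℝ) 1)
    (hm : m ∈ Set.Icc (0 : ℝ) 1) (hL : 1 ≤ L)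
    (h : min 1 √(L / (max 1 s.card : ℕ)) < |(∑ τ ∈ s, f τ) / (max 1 s.card : ℕ) - m|) :
    1 ≤ s.card ∧ s.card * √(L / s.card) ≤ |∑ τ ∈ s, (f τ - m)| := by
  rcases Nat.eq_zero_or_pos s.card with h0 | h1
  · rw [Finset.card_eq_zero] at h0
    subst h0
    simp only [Finset.card_empty, zero_le, sup_of_le_left, Nat.cast_one, div_one, Finset.sum_empty,
      zero_sub, abs_neg, abs_of_nonneg hm.1] at h
    rw [min_eq_left (by rw [Real.le_sqrt' one_pos]; simpa using hL)] at h
    exact absurd hm.2 (not_le.2 h)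
  · refine ⟨h1, ?_⟩
    rw [max_eq_right h1] at h
    have hn : (0 : ℝ) < s.card := by exact_mod_cast h1
    have hle : |(∑ τ ∈ s, f τ) / s.card - m| ≤ 1 := by
      have h1 : 0 ≤ (∑ τ ∈ s, f τ) / s.card :=
        div_nonneg (Finset.sum_nonneg fun τ hτ => (hf τ hτ).1) hn.le
      have h2 : (∑ τ ∈ s, f τ) / s.card ≤ 1 := by
        rw [div_le_one hn]
        simpa using Finset.sum_le_card_nsmul s f 1 fun τ hτ => (hf τ hτ).2
      rw [abs_le]
      constructor <;> linarith [hm.1, hm.2]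
    have h' : √(L / s.card) < |(∑ τ ∈ s, f τ) / s.card - m| := by
      rcases min_lt_iff.1 h with h | h
      · exact absurd hle (not_le.2 h)
      · exact h
    have : ∑ τ ∈ s, (f τ - m) = s.card * ((∑ τ ∈ s, f τ) / s.card - m) := by
      rw [Finset.sum_sub_distrib, Finset.sum_const, nsmul_eq_mul]
      field_simp
    rw [this, abs_mul, abs_of_pos hn]
    exact mul_le_mul_of_nonneg_left h'.le hn.le

lemma card_window_le (w t : ℕ) (p : ℕ → Prop) [DecidablePred p] :
    ((Finset.range t).filter fun τ => t < τ + w ∧ p τ).card ≤ w := by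
  refine (Finset.card_le_card (t := Finset.Ico (t - w) t) fun τ hτ => ?_).trans (by simp; omega)
  simp only [Finset.mem_filter, Finset.mem_range] at hτ
  simp only [Finset.mem_Ico]
  omega

lemma sum_indicator_mul {s s' : Finset ℕ} {p : ℕ → Prop} [DecidablePred p]
    (h : ∀ τ, τ ∈ s' ↔ τ ∈ s ∧ p τ) (f : ℕ → ℝ) :
    ∑ τ ∈ s, (if p τ then 1 else 0) * f τ = ∑ τ ∈ s', f τ := by
  have : s' = s.filter p := by ext τ; simp [h]
  simp [this, Finset.sum_filter]

lemma sum_indicator {s s' : Finset ℕ} {p : ℕ → Prop} [DecidablePred p]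
    (h : ∀ τ, τ ∈ s' ↔ τ ∈ s ∧ p τ) : ∑ τ ∈ s, (if p τ then (1 : ℝ) else 0) = s'.card := by
  simpa using sum_indicator_mul h fun _ => 1

namespace Play.IsInteraction

variable {A D : ℕ} {X : Fin D → Type*} [∀ i, Fintype (X i)] {P : Play Ω A X}
  {𝓕 : Filtration ℕ mΩ} {env : Environment A X} {T : ℕ}

lemma measure_reward_deviation (hP : P.IsInteraction μ 𝓕 env T)
    (hs : ∀ t < T, env.meanReward t = env.meanReward 0) (w : ℕ) (δ : ℝ)
    (hL : 1 ≤ Real.log ((T : ℝ) * A * psiTot X * w / δ)) :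
    μ.real {ω | ∃ t ∈ Finset.range T, ∃ i : Fin A × PartialState X,
      (P.record ω).radAct T w δ t i.1 i.2 <
        |(P.record ω).rewardHat w t i.1 i.2 - env.partialReward 0 i.1 i.2|} ≤
      2 * (T * A * psiTot X * w) * Real.exp (-(2 * Real.log ((T : ℝ) * A * psiTot X * w / δ))) := by
  classical
  refine (measureReal_exists_le (μ := μ) (Finset.range T)
    (c := fun i => 2 * w * Real.exp (-(2 * Real.log ((T : ℝ) * A * psiTot X * w / δ))))
    fun t ht i => ?_).trans (le_of_eq ?_)
  · have ht := Finset.mem_range.1 ht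
    refine (measureReal_mono ?_).trans ((hP.sampling_reward hs (fun τ => t < τ + w) i.1 i.2).measure_abs_le
      ht.le w (zero_le_one.trans hL))
    intro ω hω
    have hset (τ : ℕ) : τ ∈ (P.record ω).timesAct w t i.1 i.2 ↔ τ ∈ Finset.range t ∧
        t < τ + w ∧ P.act τ ω = i.1 ∧ P.pstate τ ω = i.2 := by
      simp
    obtain ⟨h1, h2⟩ := deviation_of_mean (s := (P.record ω).timesAct w t i.1 i.2) (f := fun τ => P.reward τ ω)
      (fun τ hτ => hP.reward_mem τ ((Record.mem_timesAct.1 hτ).1.trans ht) ω) (env.partialReward_mem 0 i.1 i.2) hL hω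
    refine ⟨_, Finset.mem_Icc.2 ⟨h1, card_window_le _ _ _⟩, ?_, ?_⟩
    · exact sum_indicator hset
    · exact h2.trans (le_of_eq (congrArg _ (sum_indicator_mul hset _).symm))
  · simp [psiTot_eq_card]
    ring

omit [∀ i, Fintype (X i)] in
lemma measure_cost_deviation (hP : P.IsInteraction μ 𝓕 env T)
    (hs : ∀ t < T, env.meanCost t = env.meanCost 0) (w : ℕ) (δ : ℝ)
    (hL : 1 ≤ D → 1 ≤ Real.log ((T : ℝ) * D * w / δ)) :
    μ.real {ω | ∃ t ∈ Finset.range T, ∃ i : Fin D, (P.record ω).radFeature T w δ t i <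
        |(P.record ω).costHat w t i - env.meanCost 0 i|} ≤
      2 * (T * D * w) * Real.exp (-(4 * Real.log ((T : ℝ) * D * w / δ))) := by
  classical
  refine (measureReal_exists_le (μ := μ) (Finset.range T)
    (c := fun i => 2 * w * Real.exp (-(2 * (2 * Real.log ((T : ℝ) * D * w / δ)))))
    fun t ht i => ?_).trans (le_of_eq ?_)
  · have ht := Finset.mem_range.1 ht
    have hL' : 1 ≤ 2 * Real.log ((T : ℝ) * D * w / δ) := by
      linarith [hL (Nat.one_le_of_lt i.2)]
    refine (measureReal_mono ?_).trans ((hP.sampling_cost hs (fun τ => t < τ + w) i).measure_abs_le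
      ht.le w (zero_le_one.trans hL'))
    intro ω hω
    have hset (τ : ℕ) : τ ∈ (P.record ω).timesFeature w t i ↔ τ ∈ Finset.range t ∧
        t < τ + w ∧ i ∈ P.obs τ ω := by
      simp
    have hT : 0 < T := by omega
    obtain ⟨h1, h2⟩ := deviation_of_mean (s := (P.record ω).timesFeature w t i)
      (f := fun τ => P.cost τ ω i)
      (fun τ hτ => hP.cost_mem τ ((Record.mem_timesFeature.1 hτ).1.trans ht) ω i) (hP.meanCost_mem hT i) hL' hω
    refine ⟨_, Finset.mem_Icc.2 ⟨h1, card_window_le _ _ _⟩, ?_, ?_⟩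
    · exact sum_indicator hset
    · exact h2.trans (le_of_eq (congrArg _ (sum_indicator_mul hset _).symm))
  · simp
    ring_nf

omit [∀ i, Fintype (X i)] in
lemma card_timesPartial (P : Play Ω A X) (t : ℕ) (ω : Ω) {I : Finset (Fin D)} (ψ : PartialOn X I)
    [∀ τ, Decidable (I ⊆ P.obs τ ω)] [∀ τ, Decidable (Consistent (P.state τ ω) ψ.1)] :
    (((P.record ω).timesPartial t ψ.1).card : ℝ) =
      ∑ τ ∈ Finset.range t, (if I ⊆ P.obs τ ω then 1 else 0) *
        (if Consistent (P.state τ ω) ψ.1 then 1 else 0) := by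
  classical
  simp_rw [ite_zero_mul_ite_zero, mul_one]
  rw [Finset.sum_boole]
  congr 2
  ext τ
  simp only [Record.mem_timesPartial, Play.record_obs, Play.record_pstate, Finset.mem_filter,
    Finset.mem_range, ψ.2]
  refine and_congr_right fun _ => and_congr_right fun h => substate_observe_iff ?_
  rwa [ψ.2]

lemma measure_partial_le (hP : P.IsInteraction μ 𝓕 env T) (I : Finset (Fin D))
    (B : Finset (PartialOn X I)) (n : ℕ) {ε : ℝ} (hε : 0 ≤ ε) :
    μ.real {ω | ∃ t ≤ T, ((P.record ω).timesObs t I).card = n ∧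
      n * ε ≤ ∑ ψ ∈ B, (((P.record ω).timesPartial t ψ.1).card - n * env.prob ψ.1)} ≤
      Real.exp (-(2 * n * ε ^ 2)) := by
  classical
  refine (measureReal_mono ?_).trans ((hP.sampling_partial I B).measure_le n hε)
  rintro ω ⟨t, ht, hn, hd⟩
  have hcard : ∑ τ ∈ Finset.range t, (if I ⊆ P.obs τ ω then (1 : ℝ) else 0) = n := by
    rw [← hn]
    exact sum_indicator fun τ => by simp
  refine ⟨t, ht, hcard, hd.trans (le_of_eq ?_)⟩
  simp_rw [card_timesPartial, mul_sub, Finset.sum_sub_distrib, ← Finset.sum_mul, hcard,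
    Finset.mul_sum]
  rw [Finset.sum_comm]

/-- The sets of rounds `𝒯_t(I)` are not windowed, so a single sampling process serves all `t`, and
only the sample size and the pair of `I` and `B` need a union bound. The at most `2 ^ psiTot X` sets
`B` for each `I` are absorbed by the factor `psiTot X` in the radius. -/
lemma measure_law_deviation (hP : P.IsInteraction μ 𝓕 env T) {L : ℝ} (hL : 0 ≤ L) :
    μ.real {ω | ∃ n ∈ Finset.Icc 1 T, ∃ i : Σ I : Finset (Fin D), Finset (PartialOn X I),
      ∃ t ≤ T, ((P.record ω).timesObs t i.1).card = n ∧ n * (√(2 * psiTot X * L / n) / 2) ≤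
        ∑ ψ ∈ i.2, (((P.record ω).timesPartial t ψ.1).card - n * env.prob ψ.1)} ≤
      T * (numObs D * (2 * Real.exp (-L)) ^ psiTot X) := by
  classical
  refine (measureReal_exists_le (μ := μ) (Finset.Icc 1 T)
    (c := fun i : Σ I : Finset (Fin D), Finset (PartialOn X I) => Real.exp (-L) ^ psiTot X)
    fun n hn i => ?_).trans ?_
  · refine (hP.measure_partial_le i.1 i.2 n (by positivity)).trans (le_of_eq ?_)
    have : (0 : ℝ) < n := by exact_mod_cast (Finset.mem_Icc.1 hn).1
    rw [← Real.exp_nat_mul, div_pow, Real.sq_sqrt (by positivity)]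
    congr 1
    field_simp
  · simp only [Nat.card_Icc, add_tsub_cancel_right]
    rw [Fintype.sum_sigma]
    refine mul_le_mul_of_nonneg_left ?_ (Nat.cast_nonneg _)
    rw [numObs, ← nsmul_eq_mul, Fintype.card]
    refine Finset.sum_le_card_nsmul _ _ _ fun I _ => ?_
    rw [Finset.sum_const, nsmul_eq_mul, Finset.card_univ, Fintype.card_finset, mul_pow]
    push_cast
    gcongr
    · norm_num
    · exact card_partialOn_le I

/-- A deviation of `1 / 2` has probability at most `exp (-n / 2)`, hence at most `y ^ B.card` with
`y = exp (-L)`. Summing over the nonempty subsets of a set of size `k` gives `(1 + y) ^ k - 1`,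
which is at most `2 * k * y` because `k * y ≤ 1`. -/
lemma measure_heavy_deviation (hP : P.IsInteraction μ 𝓕 env T) {L : ℝ}
    (hL : psiTot X * Real.exp (-L) ≤ 1) :
    μ.real {ω | ∃ n ∈ Finset.Icc 1 T, ∃ i : Σ I : Finset (Fin D), Finset (PartialOn X I),
      (i.2.Nonempty ∧ 2 * L * i.2.card ≤ n) ∧
      ∃ t ≤ T, ((P.record ω).timesObs t i.1).card = n ∧ n * (1 / 2) ≤
        ∑ ψ ∈ i.2, (((P.record ω).timesPartial t ψ.1).card - n * env.prob ψ.1)} ≤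
      T * (2 * (psiTot X * Real.exp (-L))) := by
  classical
  refine (measureReal_exists_le (μ := μ) (Finset.Icc 1 T)
    (c := fun i : Σ I : Finset (Fin D), Finset (PartialOn X I) => if i.2 = ∅ then 0 else Real.exp (-L) ^ i.2.card)
    fun n hn i => ?_).trans ?_
  · by_cases h : i.2.Nonempty ∧ 2 * L * i.2.card ≤ n
    · simp only [h, true_and, and_self]
      rw [if_neg h.1.ne_empty, ← Real.exp_nat_mul]
      refine (hP.measure_partial_le i.1 i.2 n (by positivity)).trans (Real.exp_le_exp.2 ?_)
      nlinarith [h.2]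
    · simp only [h, false_and, Set.ofPred_false, measureReal_empty]
      split_ifs <;> positivity
  · simp only [Nat.card_Icc, add_tsub_cancel_right]
    rw [Fintype.sum_sigma]
    refine mul_le_mul_of_nonneg_left ?_ (Nat.cast_nonneg _)
    set y := Real.exp (-L)
    have hy : 0 ≤ y := (Real.exp_pos _).le
    have hbound (I : Finset (Fin D)) :
        ∑ B : Finset (PartialOn X I), (if B = ∅ then 0 else y ^ B.card) ≤
          2 * (Fintype.card (PartialOn X I) * y) := by
      have h1 : ∑ B : Finset (PartialOn X I), (if B = ∅ then 0 else y ^ B.card) =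
          (y + 1) ^ Fintype.card (PartialOn X I) - 1 := by
        rw [← Fintype.sum_pow_mul_eq_add_pow, eq_sub_iff_add_eq,
          ← Fintype.sum_ite_eq (∅ : Finset (PartialOn X I)) (fun _ => (1 : ℝ)),
          ← Finset.sum_add_distrib]
        refine Finset.sum_congr rfl fun B _ => ?_
        by_cases hB : B = ∅
        · simp [hB]
        · simp [hB, Ne.symm hB]
      have h2 : (y + 1) ^ Fintype.card (PartialOn X I) ≤
          Real.exp (Fintype.card (PartialOn X I) * y) := by
        rw [Real.exp_nat_mul]
        exact pow_le_pow_left₀ (by positivity) (Real.add_one_le_exp y) _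
      have h3 : Fintype.card (PartialOn X I) * y ≤ 1 := by
        refine le_trans (mul_le_mul_of_nonneg_right ?_ hy) hL
        exact_mod_cast card_partialOn_le I
      have h4 : 0 ≤ Fintype.card (PartialOn X I) * y := by positivity
      have h5 := Real.abs_exp_sub_one_le (by rwa [abs_of_nonneg h4])
      rw [abs_of_nonneg h4] at h5
      rw [h1]
      linarith [le_abs_self (Real.exp (Fintype.card (PartialOn X I) * y) - 1)]
    refine (Finset.sum_le_sum fun I _ => hbound I).trans (le_of_eq ?_)
    rw [← Finset.mul_sum, ← Finset.sum_mul, psiTot, Nat.cast_sum]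

omit [IsProbabilityMeasure μ] [∀ i, Fintype (X i)] in
lemma act_pstate_meas (hP : P.IsInteraction μ 𝓕 env T) {τ : ℕ} (hτ : τ < T) [∀ i, Finite (X i)]
    (a : Fin A) (ψ : PartialState X) :
    MeasurableSet[𝓕 (τ + 1)] {ω | P.act τ ω = a ∧ P.pstate τ ω = ψ} := by
  have := fun i => Fintype.ofFinite (X i)
  simp_rw [act_pstate_iff]
  exact (𝓕.mono (Nat.le_succ τ) _ (hP.choice_meas hτ a ψ)).inter
    (hP.state_set_meas hτ {φ | Consistent φ ψ})

omit [IsProbabilityMeasure μ] in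
lemma radAct_meas (hP : P.IsInteraction μ 𝓕 env T) (w : ℕ) (δ : ℝ) {t : ℕ} (ht : t < T)
    (a : Fin A) (ψ : PartialState X) :
    Measurable[𝓕 t] fun ω => (P.record ω).radAct T w δ t a ψ := by
  classical
  have hc : Measurable[𝓕 t] fun ω => ((P.record ω).timesAct w t a ψ).card := by
    have h (ω : Ω) : ((P.record ω).timesAct w t a ψ).card = ∑ τ ∈ Finset.range t,
        if t < τ + w ∧ P.act τ ω = a ∧ P.pstate τ ω = ψ then 1 else 0 := by
      rw [Finset.sum_boole, Nat.cast_id]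
      congr 1
    simp_rw [h]
    refine Finset.measurable_sum _ fun τ hτ => ?_
    have hτ := Finset.mem_range.1 hτ
    exact Measurable.ite ((MeasurableSet.const _).inter (𝓕.mono hτ _
      (hP.act_pstate_meas (hτ.trans ht) a ψ))) measurable_const measurable_const
  exact (measurable_from_top (f := fun n : ℕ => min 1
    √(Real.log ((T : ℝ) * A * psiTot X * w / δ) / (max 1 n : ℕ)))).comp hc

lemma measure_policy_deviation (hP : P.IsInteraction μ 𝓕 env T) (w : ℕ) (δ : ℝ) (hT : 1 ≤ T) {L : ℝ}
    (hL : 0 ≤ L) :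
    μ.real {ω | T * √(L / T) ≤ ∑ t ∈ Finset.range T,
      ((∑ ψ : PartialOn X (P.obs t ω),
          env.prob ψ.1 * (P.record ω).radAct T w δ t (P.strat t ω ψ.1) ψ.1) -
        (P.record ω).radAct T w δ t (P.act t ω) (P.pstate t ω))} ≤ Real.exp (-(2 * L)) := by
  -- The complementary samples `1 - x` are used because the averaged radius has to be bounded by the
  -- realized one, not conversely.
  have h := (hP.sampling_policy (R := fun t ω a ψ => (P.record ω).radAct T w δ t a ψ)
    (fun t ht a ψ => hP.radAct_meas w δ ht a ψ)
    (fun t _ ω a ψ => ⟨le_min zero_le_one (Real.sqrt_nonneg _), min_le_left _ _⟩)).compl.measure_le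
    T (Real.sqrt_nonneg (L / T))
  have hT' : (0 : ℝ) < T := by exact_mod_cast hT
  have hL' : 2 * T * √(L / T) ^ 2 = 2 * L := by
    rw [Real.sq_sqrt (by positivity)]
    field_simp
  rw [hL'] at h
  refine (measureReal_mono ?_).trans h
  intro ω hω
  refine ⟨T, le_rfl, by simp, ?_⟩
  convert Set.mem_ofPred_eq ▸ hω using 2
  ring

end Play.IsInteraction

end Deviations

/-! ### Probability vectors on a finite type -/

section Simplex

variable {ι : Type*} [Fintype ι]

/-- When the sum is zero, the positive and negative parts have equal mass. One-sided bounds on sets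
thus give `L¹`-bounds. -/
lemma sum_abs_le_of_sum_le {x : ι → ℝ} {c : ℝ} (h0 : ∑ i, x i = 0)
    (h : ∑ i with 0 < x i, x i ≤ c) : ∑ i, |x i| ≤ 2 * c := by
  have : ∑ i, |x i| = 2 * ∑ i with 0 < x i, x i - ∑ i, x i := by
    rw [Finset.sum_filter, Finset.mul_sum, ← Finset.sum_sub_distrib]
    refine Finset.sum_congr rfl fun i _ => ?_
    split_ifs with hi
    · rw [abs_of_pos hi]; ring
    · rw [abs_of_nonpos (not_lt.1 hi)]; ring
  rw [this, h0]
  linarith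

lemma sum_abs_sub_le_two {p q : ι → ℝ} (hp : p ∈ stdSimplex ℝ ι) (hq : q ∈ stdSimplex ℝ ι) :
    ∑ i, |q i - p i| ≤ 2 := by
  calc ∑ i, |q i - p i| ≤ ∑ i, (q i + p i) := Finset.sum_le_sum fun i _ => by
        rw [abs_le]; constructor <;> linarith [hp.1 i, hq.1 i]
    _ = 2 := by rw [Finset.sum_add_distrib, hp.2, hq.2]; norm_num

/-- If `p'` exceeds `p` by at most `1 / 2` on sets where the optimistic values `u` are below `1`,
then moving mass to large values makes up for the difference. -/
lemma exists_optimistic {p p' u v : ι → ℝ} (hp : p ∈ stdSimplex ℝ ι) (hp' : p' ∈ stdSimplex ℝ ι)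
    (hvu : ∀ i, v i ≤ u i) (hv : ∀ i, v i ≤ 1)
    (h : ∑ i with u i < 1 ∧ p i < p' i, (p' i - p i) ≤ 1 / 2) :
    ∃ q ∈ stdSimplex ℝ ι, ∑ i, |q i - p' i| ≤ 1 ∧ ∑ i, p i * v i ≤ ∑ i, q i * u i := by
  classical
  by_cases hu : ∀ i, u i < 1
  -- No value reaches `1`, so the hypothesis covers the whole positive part of `p' - p`, and `p`
  -- itself is close enough.
  · refine ⟨p, hp, ?_, Finset.sum_le_sum fun i _ => mul_le_mul_of_nonneg_left (hvu i) (hp.1 i)⟩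
    simp only [hu, true_and] at h
    simp only [abs_sub_comm (p _)]
    have := sum_abs_le_of_sum_le (x := fun i => p' i - p i) (c := 1 / 2)
      (by rw [Finset.sum_sub_distrib, hp.2, hp'.2, sub_self]) (by simpa using h)
    linarith
  · push Not at hu
    obtain ⟨j, hj⟩ := hu
    -- The excess of `p'` over `p` on small values is removed and put on `j`, where `u j ≥ 1`.
    -- Moving mass `m` costs `2 * m ≤ 1` in `L¹`.
    let d : ι → ℝ := fun i => if u i < 1 ∧ p i < p' i then p' i - p i else 0
    have hd0 (i : ι) : 0 ≤ d i := by
      simp only [d]; split_ifs with hi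
      · linarith [hi.2]
      · exact le_rfl
    have hd1 (i : ι) : d i ≤ p' i := by
      simp only [d]; split_ifs with hi
      · linarith [hp.1 i]
      · exact hp'.1 i
    have hm : ∑ i, d i ≤ 1 / 2 := by simpa only [d, Finset.sum_filter] using h
    have hm0 : 0 ≤ ∑ i, d i := Finset.sum_nonneg fun i _ => hd0 i
    let q : ι → ℝ := fun i => p' i - d i + if i = j then ∑ i, d i else 0
    have hq0 (i : ι) : 0 ≤ q i := by
      have := hd1 i
      simp only [q]; split_ifs <;> linarith
    have hq1 : ∑ i, q i = 1 := by
      simp [q, Finset.sum_add_distrib, Finset.sum_sub_distrib, hp'.2]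
    refine ⟨q, ⟨hq0, hq1⟩, ?_, ?_⟩
    · calc ∑ i, |q i - p' i| ≤ ∑ i, (d i + if i = j then ∑ i, d i else 0) := by
            refine Finset.sum_le_sum fun i _ => ?_
            have := hd0 i
            simp only [q]
            rw [abs_le]
            split_ifs <;> constructor <;> linarith
        _ ≤ 1 := by
            rw [Finset.sum_add_distrib, Finset.sum_ite_eq']
            simp only [Finset.mem_univ, if_true]
            linarith
    -- Where `u i < 1`, the new vector satisfies `q i ≤ p i`. Elsewhere `min (u i) 1` is already
    -- maximal. So `q` does at least as well as `p` for the truncated values, which still dominate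
    -- `v`.
    · have hz : 0 ≤ ∑ i, (p i - q i) * (1 - min (u i) 1) := by
        refine Finset.sum_nonneg fun i _ => ?_
        rcases lt_or_ge (u i) 1 with hi | hi
        · refine mul_nonneg ?_ (sub_nonneg.2 (min_le_right _ _))
          have hij : i ≠ j := by rintro rfl; linarith
          simp only [q, d, hi, hij, true_and, if_false]
          split_ifs with hlt <;> linarith
        · rw [min_eq_right hi]; simp
      have hpq : ∑ i, (p i - q i) = 0 := by
        rw [Finset.sum_sub_distrib, hp.2, hq1, sub_self]
      simp_rw [mul_sub, mul_one] at hz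
      rw [Finset.sum_sub_distrib, hpq] at hz
      simp_rw [sub_mul] at hz
      rw [Finset.sum_sub_distrib] at hz
      have h1 : ∑ i, p i * v i ≤ ∑ i, p i * min (u i) 1 := Finset.sum_le_sum fun i _ =>
        mul_le_mul_of_nonneg_left (le_min (hvu i) (hv i)) (hp.1 i)
      have h2 : ∑ i, q i * min (u i) 1 ≤ ∑ i, q i * u i := Finset.sum_le_sum fun i _ =>
        mul_le_mul_of_nonneg_left (min_le_left _ _) (hq0 i)
      linarith

end Simplex

/-! ### The optimistic value on the good event -/

namespace Environment

variable {A D : ℕ} {X : Fin D → Type*} [∀ i, Fintype (X i)] (env : Environment A X)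

lemma prob_mem_stdSimplex (I : Finset (Fin D)) :
    (fun ψ : PartialOn X I => env.prob ψ.1) ∈ stdSimplex ℝ (PartialOn X I) :=
  ⟨fun ψ => env.prob_nonneg ψ.1, env.sum_prob I⟩

/-- With a single action, the rewards do not depend on the policy. -/
lemma sum_prob_mul_partialReward_of_subsingleton [Subsingleton (Fin A)] (t : ℕ) (π : Policy A X)
    (a : Fin A) : ∑ ψ : PartialOn X π.obs, env.prob ψ.1 * env.partialReward t (π.strat ψ) ψ.1 =
      env.expect (env.meanReward t a) := by
  classical
  have h (ψ : PartialOn X π.obs) : π.strat ψ = a := Subsingleton.elim _ _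
  simp_rw [h, env.prob_mul_partialReward, ← expect_sum, ← Finset.sum_mul]
  congr 1
  funext φ
  rw [sum_consistent φ fun _ => (1 : ℝ), one_mul]

end Environment

section Optimism

variable {Ω : Type*} {A D : ℕ} {X : Fin D → Type*} [∀ i, Fintype (X i)]

/-- In round `t`, the estimates along the sample point `ω` are as accurate as intended. -/
structure Accurate (P : Play Ω A X) (env : Environment A X) (T w : ℕ) (δ : ℝ) (t : ℕ) (ω : Ω) :
    Prop where
  reward : ∀ a ψ, |(P.record ω).rewardHat w t a ψ - env.partialReward 0 a ψ| ≤
    (P.record ω).radAct T w δ t a ψ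
  cost : ∀ i, |(P.record ω).costHat w t i - env.meanCost 0 i| ≤ (P.record ω).radFeature T w δ t i
  law : ∀ (I : Finset (Fin D)) (B : Finset (PartialOn X I)) (n : ℕ),
    n = ((P.record ω).timesObs t I).card → 1 ≤ n →
    ∑ ψ ∈ B, (((P.record ω).timesPartial t ψ.1).card - n * env.prob ψ.1) ≤
      n * (√(2 * psiTot X * Real.log (2 * (T : ℝ) * numObs D / δ) / n) / 2)
  heavy : 2 ≤ A → ∀ (I : Finset (Fin D)) (B : Finset (PartialOn X I)) (n : ℕ),
    n = ((P.record ω).timesObs t I).card → 1 ≤ n → B.Nonempty →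
    2 * Real.log ((T : ℝ) * A * psiTot X * w / δ) * B.card ≤ n →
    ∑ ψ ∈ B, (((P.record ω).timesPartial t ψ.1).card - n * env.prob ψ.1) ≤ n * (1 / 2)

variable {P : Play Ω A X} {env : Environment A X} {T w t : ℕ} {δ : ℝ} {ω : Ω}

omit [∀ i, Fintype (X i)] in
lemma rewardHat_mem (hr : ∀ τ < t, P.reward τ ω ∈ Set.Icc (0 : ℝ) 1) (a : Fin A)
    (ψ : PartialState X) : (P.record ω).rewardHat w t a ψ ∈ Set.Icc (0 : ℝ) 1 := by
  have h (τ : ℕ) (hτ : τ ∈ (P.record ω).timesAct w t a ψ) : P.reward τ ω ∈ Set.Icc (0 : ℝ) 1 :=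
    hr τ (Record.mem_timesAct.1 hτ).1
  refine ⟨div_nonneg (Finset.sum_nonneg fun τ hτ => (h τ hτ).1) (Nat.cast_nonneg _),
    div_le_one_of_le₀ ?_ (Nat.cast_nonneg _)⟩
  refine (Finset.sum_le_card_nsmul _ _ 1 fun τ hτ => (h τ hτ).2).trans ?_
  rw [nsmul_eq_mul, mul_one]
  exact_mod_cast le_max_right _ _

lemma radAct_mem (H : Record A X) (a : Fin A) (ψ : PartialState X) :
    H.radAct T w δ t a ψ ∈ Set.Icc (0 : ℝ) 1 :=
  ⟨le_min zero_le_one (Real.sqrt_nonneg _), min_le_left _ _⟩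

lemma rewardUp_mem (hr : ∀ τ < t, P.reward τ ω ∈ Set.Icc (0 : ℝ) 1) (a : Fin A)
    (ψ : PartialState X) : (P.record ω).rewardUp T w δ t a ψ ∈ Set.Icc (0 : ℝ) 2 := by
  have h1 := rewardHat_mem (w := w) hr a ψ
  have h2 := radAct_mem (T := T) (w := w) (t := t) (δ := δ) (P.record ω) a ψ
  constructor <;> simp only [Record.rewardUp] <;> linarith [h1.1, h1.2, h2.1, h2.2]

omit [∀ i, Fintype (X i)] in
lemma probHat_eq (H : Record A X) {I : Finset (Fin D)} (ψ : PartialOn X I) {n : ℕ}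
    (hn : n = (H.timesObs t I).card) (h1 : 1 ≤ n) :
    H.probHat t ψ.1 = ((H.timesPartial t ψ.1).card : ℝ) / n := by
  rw [Record.probHat, Record.numObsSet, ψ.2, ← hn, max_eq_right h1]

lemma sum_card_timesPartial (P : Play Ω A X) (t : ℕ) (ω : Ω) (I : Finset (Fin D)) :
    ∑ ψ : PartialOn X I, (((P.record ω).timesPartial t ψ.1).card : ℝ) =
      ((P.record ω).timesObs t I).card := by
  classical
  simp_rw [Play.IsInteraction.card_timesPartial]
  rw [Finset.sum_comm]
  simp_rw [← Finset.mul_sum, sum_consistent _ fun _ => (1 : ℝ), mul_one]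
  exact sum_indicator fun τ => by simp

lemma probHat_mem_stdSimplex {I : Finset (Fin D)} (h1 : 1 ≤ ((P.record ω).timesObs t I).card) :
    (fun ψ : PartialOn X I => (P.record ω).probHat t ψ.1) ∈ stdSimplex ℝ (PartialOn X I) := by
  refine ⟨fun ψ => div_nonneg (Nat.cast_nonneg _) (Nat.cast_nonneg _), ?_⟩
  simp_rw [probHat_eq _ _ rfl h1]
  rw [← Finset.sum_div, sum_card_timesPartial, div_self]
  exact_mod_cast Nat.one_le_iff_ne_zero.1 h1

lemma probHat_eq_zero {I : Finset (Fin D)} (h0 : ((P.record ω).timesObs t I).card = 0)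
    (ψ : PartialOn X I) : (P.record ω).probHat t ψ.1 = 0 := by
  have : ((P.record ω).timesPartial t ψ.1).card = 0 := by
    have h := sum_card_timesPartial P t ω I
    rw [h0, Nat.cast_zero, Finset.sum_eq_zero_iff_of_nonneg fun _ _ => Nat.cast_nonneg _] at h
    exact_mod_cast h ψ (Finset.mem_univ _)
  rw [Record.probHat, this]; simp

lemma sum_probHat_sub {I : Finset (Fin D)} (B : Finset (PartialOn X I)) {n : ℕ} {c : ℝ}
    (hn : n = ((P.record ω).timesObs t I).card) (h1 : 1 ≤ n)
    (h : ∑ ψ ∈ B, (((P.record ω).timesPartial t ψ.1).card - n * env.prob ψ.1) ≤ n * c) :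
    ∑ ψ ∈ B, ((P.record ω).probHat t ψ.1 - env.prob ψ.1) ≤ c := by
  have hpos : (0 : ℝ) < n := by exact_mod_cast h1
  refine le_of_mul_le_mul_left (le_trans (le_of_eq ?_) h) hpos
  rw [Finset.mul_sum]
  refine Finset.sum_congr rfl fun ψ _ => ?_
  rw [probHat_eq _ _ hn h1]
  field_simp

lemma radObs_eq_one_of_card_eq_zero {I : Finset (Fin D)} {H : Record A X}
    (hL : 1 ≤ Real.log (2 * (T : ℝ) * numObs D / δ)) (h0 : (H.timesObs t I).card = 0) :
    H.radObs T δ t I = 1 := by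
  refine min_eq_left ?_
  rw [Record.numObsSet, h0, Real.le_sqrt' one_pos]
  have : (1 : ℝ) ≤ psiTot X := by exact_mod_cast one_le_psiTot
  simp only [zero_le, sup_of_le_left, Nat.cast_one, div_one]
  nlinarith

lemma Accurate.sum_abs_probHat_sub (h : Accurate P env T w δ t ω)
    (hL : 1 ≤ Real.log (2 * (T : ℝ) * numObs D / δ)) {I : Finset (Fin D)}
    (hI : (P.record ω).radObs T δ t I < 1) :
    ∑ ψ : PartialOn X I, |(P.record ω).probHat t ψ.1 - env.prob ψ.1| ≤
      (P.record ω).radObs T δ t I := by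
  have h1 : 1 ≤ ((P.record ω).timesObs t I).card := by
    by_contra h0
    exact hI.ne (radObs_eq_one_of_card_eq_zero hL (by omega))
  have hrad : (P.record ω).radObs T δ t I = √(2 * psiTot X *
      Real.log (2 * (T : ℝ) * numObs D / δ) / ((P.record ω).timesObs t I).card) := by
    rw [Record.radObs, Record.numObsSet, max_eq_right h1] at hI ⊢
    exact min_eq_right (min_lt_iff.1 hI |>.resolve_left (lt_irrefl _)).le
  have := sum_abs_le_of_sum_le
    (x := fun ψ : PartialOn X I => (P.record ω).probHat t ψ.1 - env.prob ψ.1)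
    (by rw [Finset.sum_sub_distrib, (probHat_mem_stdSimplex h1).2, env.sum_prob, sub_self])
    (sum_probHat_sub _ rfl h1 (h.law I _ _ rfl h1))
  rw [hrad]
  linarith

/-- Below radius `1` this is the triangle inequality through the empirical law. At radius `1` the
bound is the trivial `2`, so no accuracy of the empirical law is needed there. -/
lemma Accurate.sum_abs_plausible_sub (h : Accurate P env T w δ t ω)
    (hL : 1 ≤ Real.log (2 * (T : ℝ) * numObs D / δ)) {I : Finset (Fin D)}
    {q : PartialOn X I → ℝ} (hq : q ∈ (P.record ω).plausible T δ t I) :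
    ∑ ψ : PartialOn X I, |q ψ - env.prob ψ.1| ≤ 2 * (P.record ω).radObs T δ t I := by
  rcases lt_or_ge ((P.record ω).radObs T δ t I) 1 with hI | hI
  · calc ∑ ψ : PartialOn X I, |q ψ - env.prob ψ.1| ≤ ∑ ψ : PartialOn X I,
          (|q ψ - (P.record ω).probHat t ψ.1| + |(P.record ω).probHat t ψ.1 - env.prob ψ.1|) :=
          Finset.sum_le_sum fun ψ _ => abs_sub_le _ _ _
      _ ≤ 2 * (P.record ω).radObs T δ t I := by
          rw [Finset.sum_add_distrib]
          linarith [hq.2, h.sum_abs_probHat_sub hL hI]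
  · linarith [sum_abs_sub_le_two (env.prob_mem_stdSimplex I) hq.1]

/-- Needed because the supremum of an empty set of reals is `0`. Without observations the empirical
vector is zero and not a probability vector. The true law, at distance exactly `1`, then serves as
witness. -/
lemma plausible_nonempty (env : Environment A X) (hL : 1 ≤ Real.log (2 * (T : ℝ) * numObs D / δ))
    (I : Finset (Fin D)) : ((P.record ω).plausible T δ t I).Nonempty := by
  rcases Nat.eq_zero_or_pos ((P.record ω).timesObs t I).card with h0 | h1
  · refine ⟨_, env.prob_mem_stdSimplex I, ?_⟩
    rw [radObs_eq_one_of_card_eq_zero hL h0]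
    simp only [probHat_eq_zero h0, sub_zero, abs_of_nonneg (env.prob_nonneg _), env.sum_prob, le_rfl]
  · refine ⟨_, probHat_mem_stdSimplex h1, ?_⟩
    simp only [sub_self, abs_zero, Finset.sum_const_zero]
    exact le_min zero_le_one (Real.sqrt_nonneg _)

/-- The empirical reward is nonnegative, so an optimistic value below `1` forces the radius below
`1`, that is, a count above the logarithm. -/
lemma lt_card_timesAct (hr : ∀ τ < t, P.reward τ ω ∈ Set.Icc (0 : ℝ) 1)
    (hL : 1 ≤ Real.log ((T : ℝ) * A * psiTot X * w / δ)) {a : Fin A} {ψ : PartialState X}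
    (h : (P.record ω).rewardUp T w δ t a ψ < 1) :
    Real.log ((T : ℝ) * A * psiTot X * w / δ) < ((P.record ω).timesAct w t a ψ).card := by
  have h1 : (P.record ω).radAct T w δ t a ψ < 1 := by
    have := (rewardHat_mem (w := w) hr a ψ).1
    rw [Record.rewardUp] at h
    linarith
  have hpos : (0 : ℝ) < (P.record ω).numAct w t a ψ :=
    Nat.cast_pos.2 (lt_of_lt_of_le one_pos (le_max_left _ _))
  have h2 := min_lt_iff.1 h1 |>.resolve_left (lt_irrefl _)
  rw [Real.sqrt_lt' one_pos, one_pow, div_lt_one hpos] at h2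
  have h3 : (1 : ℝ) < (P.record ω).numAct w t a ψ := hL.trans_lt h2
  have h4 : 1 < (P.record ω).numAct w t a ψ := by exact_mod_cast h3
  rw [Record.numAct] at h2 h4
  rcases max_choice 1 ((P.record ω).timesAct w t a ψ).card with h5 | h5
  · omega
  · rwa [h5] at h2

omit [∀ i, Fintype (X i)] in
lemma sum_card_timesAct_le (P : Play Ω A X) (w t : ℕ) (ω : Ω) (ψ : PartialState X) :
    ∑ a, ((P.record ω).timesAct w t a ψ).card ≤ ((P.record ω).timesPartial t ψ).card := by
  classical
  rw [← Finset.card_biUnion]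
  · refine Finset.card_le_card fun τ hτ => ?_
    simp only [Finset.mem_biUnion, Record.mem_timesAct, Play.record_pstate] at hτ
    obtain ⟨a, -, h1, -, -, h2⟩ := hτ
    have hobs := observe_eq_iff.1 h2
    simp only [Record.mem_timesPartial, Play.record_obs, Play.record_pstate, h2]
    exact ⟨h1, hobs.1.ge, ⟨⟨_, hobs.2, hobs.2⟩, subset_rfl⟩⟩
  · intro a _ b _ hab
    rw [Function.onFun, Finset.disjoint_left]
    intro τ h1 h2
    exact hab ((Record.mem_timesAct.1 h1).2.2.1.symm.trans (Record.mem_timesAct.1 h2).2.2.1)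

/-- The empirical probabilities of observed states with small optimistic rewards are not far too
large, even where the confidence region is trivial. -/
lemma Accurate.sum_probHat_sub_le_half (h : Accurate P env T w δ t ω)
    (hr : ∀ τ < t, P.reward τ ω ∈ Set.Icc (0 : ℝ) 1)
    (hL : 1 ≤ Real.log ((T : ℝ) * A * psiTot X * w / δ)) {I : Finset (Fin D)}
    (hI : 2 ≤ A ∨ I = ∅) (h1 : 1 ≤ ((P.record ω).timesObs t I).card) :
    ∑ ψ : PartialOn X I with (⨆ a, (P.record ω).rewardUp T w δ t a ψ.1) < 1 ∧
      env.prob ψ.1 < (P.record ω).probHat t ψ.1,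
        ((P.record ω).probHat t ψ.1 - env.prob ψ.1) ≤ 1 / 2 := by
  classical
  rcases hI with hA | rfl
  · refine sum_probHat_sub _ rfl h1 ?_
    set B := Finset.univ.filter fun ψ : PartialOn X I =>
      (⨆ a, (P.record ω).rewardUp T w δ t a ψ.1) < 1 ∧
        env.prob ψ.1 < (P.record ω).probHat t ψ.1 with hB
    rcases B.eq_empty_or_nonempty with hBe | hBn
    · rw [hBe, Finset.sum_empty]; positivity
    refine h.heavy hA I _ _ rfl h1 hBn ?_
    rw [← sum_card_timesPartial, mul_comm, ← nsmul_eq_mul]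
    refine (Finset.card_nsmul_le_sum B _ _ fun ψ hψ => ?_).trans
      (Finset.sum_le_univ_sum_of_nonneg fun ψ => Nat.cast_nonneg _)
    have hψ1 := (Finset.mem_filter.1 hψ).2.1
    have hA' : (2 : ℝ) ≤ A := by exact_mod_cast hA
    -- Each action has been played in `ψ` more than `L` times, in disjoint sets of rounds. The
    -- factor `2` asked for by `heavy` is where `2 ≤ A` enters.
    calc 2 * Real.log ((T : ℝ) * A * psiTot X * w / δ)
        ≤ A * Real.log ((T : ℝ) * A * psiTot X * w / δ) :=
          mul_le_mul_of_nonneg_right hA' (by linarith)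
      _ = ∑ _a : Fin A, Real.log ((T : ℝ) * A * psiTot X * w / δ) := by simp
      _ ≤ ∑ a, (((P.record ω).timesAct w t a ψ.1).card : ℝ) := Finset.sum_le_sum fun a _ =>
          (lt_card_timesAct hr hL (lt_of_le_of_lt (le_ciSup (f := fun a =>
            (P.record ω).rewardUp T w δ t a ψ.1) (Set.finite_range _).bddAbove a) hψ1)).le
      _ ≤ _ := by exact_mod_cast sum_card_timesAct_le P w t ω ψ.1
  -- On the empty observation set both laws are the point mass on the single partial state, so there
  -- is no excess.
  · have hsub : Subsingleton (PartialOn X (∅ : Finset (Fin D))) := ⟨fun ψ ψ' => by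
      ext1; funext i
      have (χ : PartialOn X (∅ : Finset (Fin D))) : χ.1 i = none := by
        have : i ∉ dom χ.1 := by rw [χ.2]; simp
        simpa using this
      rw [this, this]⟩
    have hval {f : PartialOn X (∅ : Finset (Fin D)) → ℝ} (hf : ∑ ψ, f ψ = 1) (ψ) : f ψ = 1 := by
      rw [← hf, Fintype.sum_subsingleton _ ψ]
    rw [Finset.filter_false_of_mem]
    · simp
    · intro ψ _ hψ
      exact hψ.2.ne ((hval (env.sum_prob ∅) ψ).trans (hval (probHat_mem_stdSimplex h1).2 ψ).symm)

/-- Optimism. The true law is plausible if the radius is below `1`, and also if `I` was never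
observed, since then the empirical vector is zero. In the remaining case it is replaced by a
plausible law with at least the same optimistic reward. -/
lemma Accurate.gain_le_valueUp (h : Accurate P env T w δ t ω)
    (hr : ∀ τ < t, P.reward τ ω ∈ Set.Icc (0 : ℝ) 1)
    (hL : 1 ≤ Real.log ((T : ℝ) * A * psiTot X * w / δ))
    (hL' : 1 ≤ Real.log (2 * (T : ℝ) * numObs D / δ)) (π : Policy A X)
    (hπ : 2 ≤ A ∨ π.obs = ∅) : env.gain 0 π ≤ (P.record ω).valueUp T w δ t π.obs := by
  set u : PartialOn X π.obs → ℝ := fun ψ => ⨆ a, (P.record ω).rewardUp T w δ t a ψ.1 with hu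
  have hle (a : Fin A) (ψ : PartialOn X π.obs) : (P.record ω).rewardUp T w δ t a ψ.1 ≤ u ψ :=
    le_ciSup (f := fun a => (P.record ω).rewardUp T w δ t a ψ.1) (Set.finite_range _).bddAbove a
  have hvu (ψ : PartialOn X π.obs) : env.partialReward 0 (π.strat ψ) ψ.1 ≤ u ψ := by
    refine le_trans ?_ (hle (π.strat ψ) ψ)
    have := (abs_le.1 (h.reward (π.strat ψ) ψ.1)).1
    rw [Record.rewardUp]
    linarith
  have hp := env.prob_mem_stdSimplex (A := A) π.obs
  have hq : ∃ q ∈ (P.record ω).plausible T δ t π.obs,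
      ∑ ψ : PartialOn X π.obs, env.prob ψ.1 * env.partialReward 0 (π.strat ψ) ψ.1 ≤
        ∑ ψ, q ψ * u ψ := by
    have hpu : ∑ ψ : PartialOn X π.obs, env.prob ψ.1 * env.partialReward 0 (π.strat ψ) ψ.1 ≤
        ∑ ψ : PartialOn X π.obs, env.prob ψ.1 * u ψ := Finset.sum_le_sum fun ψ _ =>
      mul_le_mul_of_nonneg_left (hvu ψ) (env.prob_nonneg _)
    rcases lt_or_ge ((P.record ω).radObs T δ t π.obs) 1 with hI | hI
    · refine ⟨_, ⟨hp, ?_⟩, hpu⟩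
      simp only [abs_sub_comm (env.prob _)]
      exact h.sum_abs_probHat_sub hL' hI
    rcases Nat.eq_zero_or_pos ((P.record ω).timesObs t π.obs).card with h0 | h1
    · refine ⟨_, ⟨hp, ?_⟩, hpu⟩
      simpa only [probHat_eq_zero h0, sub_zero, abs_of_nonneg (env.prob_nonneg _), env.sum_prob]
        using hI
    · obtain ⟨q, hq, hqd, hqv⟩ := exists_optimistic hp (probHat_mem_stdSimplex h1) hvu
        (fun ψ => (env.partialReward_mem 0 (π.strat ψ) ψ.1).2)
        (h.sum_probHat_sub_le_half hr hL hπ h1)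
      exact ⟨q, ⟨hq, hqd.trans hI⟩, hqv⟩
  obtain ⟨q, hq, hqv⟩ := hq
  have hbdd : BddAbove ((fun q : PartialOn X π.obs → ℝ => ∑ ψ : PartialOn X π.obs, q ψ * u ψ
      - ∑ i ∈ π.obs, (P.record ω).costLow T w δ t i) '' (P.record ω).plausible T δ t π.obs) := by
    refine ⟨∑ ψ, |u ψ| - ∑ i ∈ π.obs, (P.record ω).costLow T w δ t i, ?_⟩
    rintro _ ⟨q, hq, rfl⟩
    refine sub_le_sub_right (Finset.sum_le_sum fun ψ _ => ?_) _
    have h0 := hq.1.1 ψ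
    have h1 : q ψ ≤ 1 := hq.1.2 ▸ Finset.single_le_sum (fun i _ => hq.1.1 i) (Finset.mem_univ ψ)
    nlinarith [le_abs_self (u ψ), abs_nonneg (u ψ)]
  refine le_trans ?_ (le_csSup hbdd ⟨q, hq, rfl⟩)
  refine sub_le_sub hqv (Finset.sum_le_sum fun i _ => ?_)
  have := (abs_le.1 (h.cost i)).2
  rw [Record.costLow]
  linarith

/-- The factor `4` is the `L¹`-distance of at most twice the radius times optimistic rewards of at
most `2`. Each factor `2` is an estimation error plus the bonus that was added. -/
lemma Accurate.valueUp_le (h : Accurate P env T w δ t ω)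
    (hr : ∀ τ < t, P.reward τ ω ∈ Set.Icc (0 : ℝ) 1)
    (hL' : 1 ≤ Real.log (2 * (T : ℝ) * numObs D / δ))
    (hs : ∀ ψ a, (P.record ω).rewardUp T w δ t a ψ ≤
      (P.record ω).rewardUp T w δ t (P.strat t ω ψ) ψ) :
    (P.record ω).valueUp T w δ t (P.obs t ω) ≤ env.gain 0 (P.policy t ω) +
      (4 * (P.record ω).radObs T δ t (P.obs t ω) + 2 * ∑ ψ : PartialOn X (P.obs t ω),
          env.prob ψ.1 * (P.record ω).radAct T w δ t (P.strat t ω ψ.1) ψ.1 +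
        2 * ∑ i ∈ P.obs t ω, (P.record ω).radFeature T w δ t i) := by
  refine csSup_le ((plausible_nonempty env hL' _).image _) ?_
  rintro _ ⟨q, hq, rfl⟩
  have h1 : ∑ ψ : PartialOn X (P.obs t ω), q ψ * (⨆ a, (P.record ω).rewardUp T w δ t a ψ.1) ≤
      ∑ ψ : PartialOn X (P.obs t ω), (env.prob ψ.1 * env.partialReward 0 (P.strat t ω ψ.1) ψ.1 +
        |q ψ - env.prob ψ.1| * 2 + env.prob ψ.1 *
          (P.record ω).radAct T w δ t (P.strat t ω ψ.1) ψ.1 * 2) := by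
    refine Finset.sum_le_sum fun ψ _ => ?_
    have hne : Nonempty (Fin A) := ⟨P.strat t ω ψ.1⟩
    have hu : (⨆ a, (P.record ω).rewardUp T w δ t a ψ.1) =
        (P.record ω).rewardUp T w δ t (P.strat t ω ψ.1) ψ.1 :=
      le_antisymm (ciSup_le (hs ψ.1)) (le_ciSup (f := fun a =>
        (P.record ω).rewardUp T w δ t a ψ.1) (Set.finite_range _).bddAbove _)
    rw [hu]
    have hm := rewardUp_mem (T := T) (w := w) (δ := δ) hr (P.strat t ω ψ.1) ψ.1
    have hw := (abs_le.1 (h.reward (P.strat t ω ψ.1) ψ.1)).2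
    have h2 : (P.record ω).rewardUp T w δ t (P.strat t ω ψ.1) ψ.1 ≤
        env.partialReward 0 (P.strat t ω ψ.1) ψ.1 +
          2 * (P.record ω).radAct T w δ t (P.strat t ω ψ.1) ψ.1 := by
      rw [Record.rewardUp]; linarith
    have h3 := mul_le_mul_of_nonneg_left h2 (env.prob_nonneg ψ.1)
    have h4 : (q ψ - env.prob ψ.1) * (P.record ω).rewardUp T w δ t (P.strat t ω ψ.1) ψ.1 ≤
        |q ψ - env.prob ψ.1| * 2 :=
      (mul_le_mul_of_nonneg_right (le_abs_self _) hm.1).trans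
        (mul_le_mul_of_nonneg_left hm.2 (abs_nonneg _))
    nlinarith
  simp only [Finset.sum_add_distrib, ← Finset.sum_mul] at h1
  have h5 := h.sum_abs_plausible_sub hL' hq
  have h6 : ∑ i ∈ P.obs t ω, env.meanCost 0 i ≤ ∑ i ∈ P.obs t ω, (P.record ω).costLow T w δ t i +
      2 * ∑ i ∈ P.obs t ω, (P.record ω).radFeature T w δ t i := by
    rw [Finset.mul_sum, ← Finset.sum_add_distrib]
    refine Finset.sum_le_sum fun i _ => ?_
    have := (abs_le.1 (h.cost i)).1
    rw [Record.costLow]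
    linarith
  have h7 : ∑ ψ : PartialOn X (P.obs t ω), q ψ * (⨆ a, (P.record ω).rewardUp T w δ t a ψ.1) -
      ∑ i ∈ P.obs t ω, (P.record ω).costLow T w δ t i ≤
      (∑ ψ : PartialOn X (P.obs t ω), env.prob ψ.1 * env.partialReward 0 (P.strat t ω ψ.1) ψ.1 -
        ∑ i ∈ P.obs t ω, env.meanCost 0 i) +
      (4 * (P.record ω).radObs T δ t (P.obs t ω) + 2 * ∑ ψ : PartialOn X (P.obs t ω),
          env.prob ψ.1 * (P.record ω).radAct T w δ t (P.strat t ω ψ.1) ψ.1 +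
        2 * ∑ i ∈ P.obs t ω, (P.record ω).radFeature T w δ t i) := by linarith
  exact h7
end Optimism

/-! ### Sums of confidence radii -/

section Pigeonhole

/-- A telescoping bound: `1 / √k ≤ 3 * (√(k + 1) - √k)` for `k ≥ 1`, because `√(k + 1) ≤ 2 * √k`.
The first term, where the count `0` is replaced by `1`, is covered by the constant `3`. -/
lemma sum_inv_sqrt_count_le (p : ℕ → Prop) [DecidablePred p] (s n : ℕ) :
    ∑ t ∈ Finset.Ico s (s + n) with p t,
      1 / √((max 1 ((Finset.Ico s t).filter p).card : ℕ) : ℝ) ≤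
        3 * √(((Finset.Ico s (s + n)).filter p).card) := by
  induction n with
  | zero => simp
  | succ n ih =>
    rw [← add_assoc, ← Finset.insert_Ico_right_eq_Ico_add_one (Nat.le_add_right s n),
      Finset.filter_insert]
    split_ifs with hp
    · have hnot : s + n ∉ (Finset.Ico s (s + n)).filter p := by simp
      rw [Finset.sum_insert hnot, Finset.card_insert_of_notMem hnot]
      generalize ((Finset.Ico s (s + n)).filter p).card = k at ih ⊢
      rcases Nat.eq_zero_or_pos k with rfl | hk
      · simp at ih ⊢
        linarith
      · rw [max_eq_right hk]
        have hk1 : (1 : ℝ) ≤ k := by exact_mod_cast hk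
        set a := √(k : ℝ) with ha
        set b := √((k + 1 : ℕ) : ℝ) with hb
        have ha2 : a ^ 2 = k := Real.sq_sqrt (by positivity)
        have hb2 : b ^ 2 = k + 1 := by rw [Real.sq_sqrt (by positivity)]; push_cast; ring
        have ha1 : 1 ≤ a := by rw [ha, Real.one_le_sqrt]; exact hk1
        have hb0 : 0 ≤ b := Real.sqrt_nonneg _
        have hb3 : b ≤ 2 * a := by nlinarith
        have hab : a ≤ b := Real.sqrt_le_sqrt (by push_cast; linarith)
        have : 1 / a ≤ 3 * b - 3 * a := by
          rw [div_le_iff₀ (by linarith)]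
          have h1 : (b - a) * (b + a) = 1 := by nlinarith
          have h2 : (b - a) * (b + a) ≤ (b - a) * (3 * a) :=
            mul_le_mul_of_nonneg_left (by linarith) (by linarith)
          linarith
        linarith
    · exact ih

lemma sum_sqrt_le {κ : Type*} [Fintype κ] (f : κ → ℕ) :
    ∑ i, √(f i : ℝ) ≤ √(Fintype.card κ * (∑ i, f i : ℕ)) := by
  refine Real.le_sqrt_of_sq_le ?_
  have := sq_sum_le_card_mul_sum_sq (s := Finset.univ) (f := fun i => √(f i : ℝ))
  simpa [Real.sq_sqrt] using this

/-- The rounds are split by the value of the key, and the square roots of the class sizes are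
combined by Cauchy–Schwarz. -/
lemma sum_inv_sqrt_count_key_le {κ : Type*} [Fintype κ] [DecidableEq κ] (k : ℕ → κ) (s n : ℕ) :
    ∑ t ∈ Finset.Ico s (s + n),
      1 / √((max 1 ((Finset.Ico s t).filter fun τ => k τ = k t).card : ℕ) : ℝ) ≤
        3 * √(Fintype.card κ * n) := by
  calc _ = ∑ c, ∑ t ∈ Finset.Ico s (s + n) with k t = c,
        1 / √((max 1 ((Finset.Ico s t).filter fun τ => k τ = k t).card : ℕ) : ℝ) :=
        (Finset.sum_fiberwise _ _ _).symm
    _ = ∑ c, ∑ t ∈ Finset.Ico s (s + n) with k t = c,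
        1 / √((max 1 ((Finset.Ico s t).filter fun τ => k τ = c).card : ℕ) : ℝ) := by
        refine Finset.sum_congr rfl fun c _ => Finset.sum_congr rfl fun t ht => ?_
        rw [(Finset.mem_filter.1 ht).2]
    _ ≤ ∑ c, 3 * √(((Finset.Ico s (s + n)).filter fun t => k t = c).card) :=
        Finset.sum_le_sum fun c _ => sum_inv_sqrt_count_le (fun t => k t = c) s n
    _ ≤ 3 * √(Fintype.card κ * n) := by
        rw [← Finset.mul_sum]
        refine mul_le_mul_of_nonneg_left ((sum_sqrt_le _).trans (le_of_eq ?_)) (by norm_num)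
        rw [← Finset.card_eq_sum_card_fiberwise fun _ _ => Finset.mem_coe.2 (Finset.mem_univ _)]
        simp

/-- A sum over `T` rounds, bounded on blocks of at most `w` rounds. -/
lemma sum_range_le_of_blocks {f : ℕ → ℝ} {c : ℝ} (hc : 0 ≤ c) {w : ℕ} (hw : 1 ≤ w)
    (h : ∀ s n, n ≤ w → ∑ t ∈ Finset.Ico s (s + n), f t ≤ c * √n) (T : ℕ) :
    ∑ t ∈ Finset.range T, f t ≤ c * (T / √w + √T) := by
  have hq (q : ℕ) : ∑ t ∈ Finset.range (w * q), f t ≤ q * (c * √w) := by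
    induction q with
    | zero => simp
    | succ q ih =>
      rw [Finset.range_eq_Ico, mul_add, mul_one, ← Finset.sum_Ico_consecutive f (Nat.zero_le _)
        (Nat.le_add_right (w * q) w), ← Finset.range_eq_Ico]
      push_cast
      linarith [h (w * q) w le_rfl]
  have hw' : (0 : ℝ) < w := by exact_mod_cast hw
  have hsum : ∑ t ∈ Finset.range T, f t ≤ (T / w : ℕ) * (c * √w) + c * √(T % w : ℕ) := by
    conv_lhs => rw [← Nat.div_add_mod T w]
    rw [Finset.range_eq_Ico, ← Finset.sum_Ico_consecutive f (Nat.zero_le _)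
      (Nat.le_add_right (w * (T / w)) (T % w)), ← Finset.range_eq_Ico]
    exact add_le_add (hq _) (h _ _ (Nat.mod_lt _ hw).le)
  have h1 : ((T / w : ℕ) : ℝ) * √w ≤ T / √w := by
    rw [le_div_iff₀ (Real.sqrt_pos.2 hw'), mul_assoc, Real.mul_self_sqrt hw'.le]
    exact_mod_cast Nat.div_mul_le_self T w
  have h2 : √((T % w : ℕ) : ℝ) ≤ √T := Real.sqrt_le_sqrt (by exact_mod_cast Nat.mod_le T w)
  nlinarith [mul_le_mul_of_nonneg_left h1 hc, mul_le_mul_of_nonneg_left h2 hc]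

lemma min_one_sqrt_div_le {L : ℝ} {N n : ℕ} (h : n ≤ N) :
    min 1 √(L / (max 1 N : ℕ)) ≤ √L * (1 / √(max 1 n : ℕ)) := by
  refine (min_le_right _ _).trans ?_
  rw [Real.sqrt_div' _ (Nat.cast_nonneg _), mul_one_div]
  refine div_le_div_of_nonneg_left (Real.sqrt_nonneg _) (Real.sqrt_pos.2 ?_) (Real.sqrt_le_sqrt ?_)
  · exact Nat.cast_pos.2 (lt_of_lt_of_le one_pos (le_max_left _ _))
  · exact_mod_cast max_le_max_left 1 h

end Pigeonhole

namespace Record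

variable {A D : ℕ} {X : Fin D → Type*} [∀ i, Fintype (X i)] (H : Record A X) (T : ℕ) (δ : ℝ)

lemma sum_radAct_le {w : ℕ} (hw : 1 ≤ w) :
    ∑ t ∈ Finset.range T, H.radAct T w δ t (H.act t) (H.pstate t) ≤
      3 * √(A * psiTot X * Real.log ((T : ℝ) * A * psiTot X * w / δ)) * (T / √w + √T) := by
  classical
  refine sum_range_le_of_blocks (by positivity) hw (fun s n hn => ?_) T
  calc ∑ t ∈ Finset.Ico s (s + n), H.radAct T w δ t (H.act t) (H.pstate t)
      ≤ ∑ t ∈ Finset.Ico s (s + n), √(Real.log ((T : ℝ) * A * psiTot X * w / δ)) *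
        (1 / √((max 1 ((Finset.Ico s t).filter fun τ =>
          (H.act τ, H.pstate τ) = (H.act t, H.pstate t)).card : ℕ) : ℝ)) := by
        refine Finset.sum_le_sum fun t ht => min_one_sqrt_div_le (Finset.card_le_card fun τ hτ => ?_)
        simp only [Finset.mem_filter, Finset.mem_Ico, Prod.mk.injEq] at hτ ht
        -- Rounds of a block are less than `w` apart, so the earlier one lies in the window of the
        -- later one.
        exact mem_timesAct.2 ⟨by omega, by omega, hτ.2⟩
    _ ≤ √(Real.log ((T : ℝ) * A * psiTot X * w / δ)) *
        (3 * √(Fintype.card (Fin A × PartialState X) * n)) := by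
        rw [← Finset.mul_sum]
        exact mul_le_mul_of_nonneg_left
          (sum_inv_sqrt_count_key_le (fun t => (H.act t, H.pstate t)) s n) (Real.sqrt_nonneg _)
    _ = _ := by
        rw [Fintype.card_prod, Fintype.card_fin, ← psiTot_eq_card]
        push_cast
        rw [Real.sqrt_mul (by positivity) (n : ℝ), Real.sqrt_mul (by positivity) (Real.log _)]
        ring

-- A round may observe several features, so features are not a key. Each contributes up to `√n` per
-- block, whence the factor `D` outside the root.
omit [∀ i, Fintype (X i)] in
lemma sum_radFeature_le {w : ℕ} (hw : 1 ≤ w) :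
    ∑ t ∈ Finset.range T, ∑ i ∈ H.obs t, H.radFeature T w δ t i ≤
      3 * (D * √(2 * Real.log ((T : ℝ) * D * w / δ))) * (T / √w + √T) := by
  classical
  refine sum_range_le_of_blocks (by positivity) hw (fun s n hn => ?_) T
  set L := 2 * Real.log ((T : ℝ) * D * w / δ)
  calc ∑ t ∈ Finset.Ico s (s + n), ∑ i ∈ H.obs t, H.radFeature T w δ t i
      = ∑ i, ∑ t ∈ Finset.Ico s (s + n) with i ∈ H.obs t, H.radFeature T w δ t i := by
        refine Finset.sum_comm' fun t i => ?_
        simp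
    _ ≤ ∑ _i : Fin D, √L * (3 * √n) := by
        refine Finset.sum_le_sum fun i _ => ?_
        calc ∑ t ∈ Finset.Ico s (s + n) with i ∈ H.obs t, H.radFeature T w δ t i
            ≤ ∑ t ∈ Finset.Ico s (s + n) with i ∈ H.obs t, √L *
              (1 / √((max 1 ((Finset.Ico s t).filter fun τ => i ∈ H.obs τ).card : ℕ) : ℝ)) := by
              refine Finset.sum_le_sum fun t ht =>
                min_one_sqrt_div_le (Finset.card_le_card fun τ hτ => ?_)
              simp only [Finset.mem_filter, Finset.mem_Ico] at hτ ht
              exact mem_timesFeature.2 ⟨by omega, by omega, hτ.2⟩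
          _ ≤ √L * (3 * √n) := by
              rw [← Finset.mul_sum]
              refine mul_le_mul_of_nonneg_left ((sum_inv_sqrt_count_le (fun t => i ∈ H.obs t)
                s n).trans (mul_le_mul_of_nonneg_left (Real.sqrt_le_sqrt ?_) (by norm_num)))
                (Real.sqrt_nonneg _)
              exact_mod_cast (Finset.card_filter_le _ _).trans (by simp)
    _ = _ := by
        simp
        ring

lemma sum_radObs_le :
    ∑ t ∈ Finset.range T, H.radObs T δ t (H.obs t) ≤
      √(2 * psiTot X * Real.log (2 * (T : ℝ) * numObs D / δ)) * (3 * √(numObs D * T)) := by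
  classical
  have h := sum_inv_sqrt_count_key_le H.obs 0 T
  rw [zero_add, ← Finset.range_eq_Ico, ← numObs] at h
  refine le_trans ?_ (mul_le_mul_of_nonneg_left h (Real.sqrt_nonneg _))
  rw [Finset.mul_sum]
  refine Finset.sum_le_sum fun t _ => min_one_sqrt_div_le (Finset.card_le_card fun τ hτ => ?_)
  simp only [Finset.mem_filter, Finset.mem_Ico] at hτ
  exact mem_timesObs.2 ⟨hτ.1.2, hτ.2.ge⟩

end Record

/-! ### The regret bound -/

section Stationary

variable {A D : ℕ} {X : Fin D → Type*} {env : Environment A X} {T : ℕ}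

lemma Environment.stationary (h : env.numChanges T = 0) {t : ℕ} (ht : t < T) :
    env.meanReward t = env.meanReward 0 ∧ env.meanCost t = env.meanCost 0 := by
  -- Infinite sets also have `Set.ncard` zero, so finiteness is needed to conclude that there is no
  -- change.
  have hfin : {t : ℕ | t + 1 < T ∧ (env.meanReward (t + 1) ≠ env.meanReward t ∨
      env.meanCost (t + 1) ≠ env.meanCost t)}.Finite :=
    (Set.finite_Iio T).subset fun t ht => Set.mem_Iio.2 ((Nat.lt_succ_self t).trans ht.1)
  rw [Environment.numChanges, Set.ncard_eq_zero hfin] at h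
  induction t with
  | zero => exact ⟨rfl, rfl⟩
  | succ t ih =>
    obtain ⟨h1, h2⟩ := ih (Nat.lt_of_succ_lt ht)
    have h3 := Set.eq_empty_iff_forall_notMem.1 h t
    simp only [Set.mem_ofPred_eq, ht, true_and, not_or, not_not] at h3
    exact ⟨h3.1.trans h1, h3.2.trans h2⟩

lemma Environment.gain_eq [∀ i, Fintype (X i)] (h : env.numChanges T = 0) {t : ℕ} (ht : t < T)
    (π : Policy A X) : env.gain t π = env.gain 0 π := by
  obtain ⟨h1, h2⟩ := Environment.stationary h ht
  simp only [Environment.gain, Environment.partialReward, h1, h2]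

end Stationary

section Regret

variable {Ω : Type*} {mΩ : MeasurableSpace Ω} {μ : Measure Ω} [IsProbabilityMeasure μ]
  {A D : ℕ} {X : Fin D → Type*} [∀ i, Fintype (X i)] {P : Play Ω A X}
  {𝓕 : Filtration ℕ mΩ} {env : Environment A X} {T w : ℕ} {δ : ℝ}

/-- This is `exp 1 < 3`. It is the only reason for the threshold `1 / 3` in the logarithms. -/
lemma one_le_log_div (hδ : 0 < δ) (hδ' : δ < 1 / 3) {c : ℝ} (hc : 1 ≤ c) :
    1 ≤ Real.log (c / δ) := by
  rw [Real.le_log_iff_exp_le (by positivity), le_div_iff₀ hδ]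
  have h1 := Real.exp_one_lt_d9
  have h2 : Real.exp 1 * δ ≤ 2.7182818286 * (1 / 3) :=
    mul_le_mul h1.le hδ'.le hδ.le (by norm_num)
  linarith

/-- Per-round regret on the good event. -/
lemma Accurate.regret_round_le {t : ℕ} {ω : Ω} (hA : 1 ≤ A)
    (hP : P.IsInteraction μ 𝓕 env T) (hs : env.numChanges T = 0) (ht : t < T)
    (halg : P.FollowsNCCUCRL2 T w δ) (h : Accurate P env T w δ t ω)
    (hL : 1 ≤ Real.log ((T : ℝ) * A * psiTot X * w / δ))
    (hL' : 1 ≤ Real.log (2 * (T : ℝ) * numObs D / δ)) :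
    env.optGain t - env.gain t (P.policy t ω) ≤
      4 * (P.record ω).radObs T δ t (P.obs t ω) + 2 * ∑ ψ : PartialOn X (P.obs t ω),
          env.prob ψ.1 * (P.record ω).radAct T w δ t (P.strat t ω ψ.1) ψ.1 +
        2 * ∑ i ∈ P.obs t ω, (P.record ω).radFeature T w δ t i := by
  obtain ⟨hobs, hstrat⟩ := halg ω t ht
  have hr (τ : ℕ) (hτ : τ < t) : P.reward τ ω ∈ Set.Icc (0 : ℝ) 1 := hP.reward_mem τ (hτ.trans ht) ω
  have hup := h.valueUp_le hr hL' hstrat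
  have hne : Nonempty (Policy A X) := ⟨P.policy t ω⟩
  have hopt : env.optGain t ≤ (P.record ω).valueUp T w δ t (P.obs t ω) := by
    refine ciSup_le fun π => ?_
    rw [Environment.gain_eq hs ht]
    rcases Nat.lt_or_ge 1 A with hA2 | hA1
    · exact (h.gain_le_valueUp hr hL hL' π (Or.inl hA2)).trans (hobs _)
    -- With one action all policies have the same expected reward, and costs are nonnegative. It is
    -- enough to be optimistic about observing nothing.
    · obtain rfl : A = 1 := le_antisymm hA1 hA
      refine le_trans ?_ ((h.gain_le_valueUp hr hL hL' ⟨∅, fun _ => 0⟩ (Or.inr rfl)).trans (hobs ∅))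
      rw [Environment.gain, Environment.gain,
        env.sum_prob_mul_partialReward_of_subsingleton 0 π 0,
        env.sum_prob_mul_partialReward_of_subsingleton 0 ⟨∅, fun _ => 0⟩ 0]
      have : 0 ≤ ∑ i ∈ π.obs, env.meanCost 0 i := Finset.sum_nonneg fun i _ =>
        (hP.meanCost_mem (Nat.zero_lt_of_lt ht) i).1
      simpa using this
  rw [Environment.gain_eq hs ht]
  linarith

/-- The algorithm's estimates are accurate and its policies typical with high probability. -/
lemma measure_not_accurate_le (hA : 1 ≤ A) (hP : P.IsInteraction μ 𝓕 env T)
    (hs : env.numChanges T = 0) (hT : 1 ≤ T) (hw : 1 ≤ w) (hδ : 0 < δ) (hδ' : δ < 1 / 3) :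
    μ.real {ω | ¬ ((∀ t < T, Accurate P env T w δ t ω) ∧ ∑ t ∈ Finset.range T,
      ((∑ ψ : PartialOn X (P.obs t ω),
          env.prob ψ.1 * (P.record ω).radAct T w δ t (P.strat t ω ψ.1) ψ.1) -
        (P.record ω).radAct T w δ t (P.act t ω) (P.pstate t ω)) <
      T * √(2 * Real.log (1 / δ) / T))} ≤ 3 * δ := by
  have hT1 : (1 : ℝ) ≤ T := by exact_mod_cast hT
  have hw1 : (1 : ℝ) ≤ w := by exact_mod_cast hw
  have hA1 : (1 : ℝ) ≤ A := by exact_mod_cast hA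
  have hP1 : (1 : ℝ) ≤ psiTot X := by exact_mod_cast one_le_psiTot
  have hN1 : (1 : ℝ) ≤ numObs D := by exact_mod_cast one_le_numObs
  have hTAPw : 1 ≤ (T : ℝ) * A * psiTot X * w := by
    have := one_le_mul_of_one_le_of_one_le (one_le_mul_of_one_le_of_one_le
      (one_le_mul_of_one_le_of_one_le hT1 hA1) hP1) hw1
    exact this
  have hTN : 1 ≤ (T : ℝ) * numObs D := one_le_mul_of_one_le_of_one_le hT1 hN1
  have hexp {c : ℝ} (hc : 0 < c) : Real.exp (-Real.log (c / δ)) = δ / c := by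
    rw [Real.exp_neg, Real.exp_log (by positivity), inv_div]
  have hexp2 (n : ℕ) (L : ℝ) : Real.exp (-(n * L)) = Real.exp (-L) ^ n := by
    rw [← Real.exp_nat_mul]; congr 1; ring
  have hR := hP.measure_reward_deviation (fun t ht => (Environment.stationary hs ht).1) w δ
    (one_le_log_div hδ hδ' hTAPw)
  have hC := hP.measure_cost_deviation (fun t ht => (Environment.stationary hs ht).2) w δ
    (fun hD => one_le_log_div hδ hδ' (one_le_mul_of_one_le_of_one_le
      (one_le_mul_of_one_le_of_one_le hT1 (by exact_mod_cast hD)) hw1))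
  have hB := hP.measure_law_deviation (L := Real.log (2 * (T : ℝ) * numObs D / δ))
    (zero_le_one.trans (one_le_log_div hδ hδ' (by linarith)))
  have hZ := hP.measure_policy_deviation w δ hT (L := 2 * Real.log (1 / δ))
    (by linarith [one_le_log_div hδ hδ' le_rfl])
  set LA := Real.log ((T : ℝ) * A * psiTot X * w / δ) with hLA
  have hyA : Real.exp (-LA) = δ / (T * A * psiTot X * w) := hexp (by linarith)
  -- With `M = T * A * psiTot X * w` the left side is `2 * δ ^ 2 / M`, and `δ < 1 / 3`.
  have hR' : 2 * ((T : ℝ) * A * psiTot X * w) * Real.exp (-(2 * LA)) ≤ 2 / 3 * δ := by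
    have h2 := hexp2 2 LA
    push_cast at h2
    rw [h2, hyA, div_pow, mul_div_assoc', div_le_iff₀ (by positivity)]
    have : δ * (T * A * psiTot X * w) ≤ 1 / 3 * (T * A * psiTot X * w) ^ 2 := by nlinarith
    nlinarith
  have hC' : 2 * ((T : ℝ) * D * w) * Real.exp (-(4 * Real.log ((T : ℝ) * D * w / δ))) ≤
      1 / 9 * δ := by
    -- For `D = 0` the prefactor vanishes, and the logarithm has its default value `log 0 = 0`.
    rcases Nat.eq_zero_or_pos D with h0 | hD
    · simp [h0]; positivity
    have hc : 1 ≤ (T : ℝ) * D * w := one_le_mul_of_one_le_of_one_le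
      (one_le_mul_of_one_le_of_one_le hT1 (by exact_mod_cast hD)) hw1
    have h2 := hexp2 4 (Real.log ((T : ℝ) * D * w / δ))
    push_cast at h2
    rw [h2, hexp (by linarith)]
    set c := (T : ℝ) * D * w
    have h3 : δ / c ≤ 1 / 3 := (div_le_self hδ.le hc).trans hδ'.le
    have h4 : 0 ≤ δ / c := by positivity
    have h5 : (δ / c) ^ 3 ≤ (1 / 3) ^ 3 := pow_le_pow_left₀ h4 h3 3
    calc 2 * c * (δ / c) ^ 4 = 2 * δ * (δ / c) ^ 3 := by field_simp
      _ ≤ 2 * δ * (1 / 3) ^ 3 := mul_le_mul_of_nonneg_left h5 (by positivity)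
      _ ≤ 1 / 9 * δ := by linarith
  have hB' : (T : ℝ) * (numObs D * (2 * Real.exp (-Real.log (2 * (T : ℝ) * numObs D / δ))) ^
      psiTot X) ≤ δ := by
    rw [hexp (by linarith)]
    have h1 : 2 * (δ / (2 * T * numObs D)) = δ / (T * numObs D) := by field_simp
    rw [h1]
    have h2 : (δ / (T * numObs D)) ^ psiTot X ≤ δ / (T * numObs D) :=
      pow_le_of_le_one (by positivity) ((div_le_self hδ.le hTN).trans (by linarith))
        (Nat.one_le_iff_ne_zero.1 one_le_psiTot)
    calc (T : ℝ) * (numObs D * (δ / (T * numObs D)) ^ psiTot X)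
        ≤ T * (numObs D * (δ / (T * numObs D))) := by gcongr
      _ = δ := by field_simp
  have hZ' : Real.exp (-(2 * (2 * Real.log (1 / δ)))) ≤ 1 / 9 * δ := by
    have h2 := hexp2 4 (Real.log (1 / δ))
    push_cast at h2
    rw [← mul_assoc, show (2 * 2 : ℝ) = 4 by norm_num, h2, hexp one_pos, div_one]
    have : δ ^ 3 ≤ (1 / 3) ^ 3 := pow_le_pow_left₀ hδ.le hδ'.le 3
    nlinarith
  have hH : μ.real {ω | 2 ≤ A ∧ ∃ n ∈ Finset.Icc 1 T,
      ∃ i : Σ I : Finset (Fin D), Finset (PartialOn X I),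
      (i.2.Nonempty ∧ 2 * LA * i.2.card ≤ n) ∧
      ∃ t ≤ T, ((P.record ω).timesObs t i.1).card = n ∧ n * (1 / 2) ≤
        ∑ ψ ∈ i.2, (((P.record ω).timesPartial t ψ.1).card - n * env.prob ψ.1)} ≤ δ := by
    by_cases hA2 : 2 ≤ A
    · have hA3 : (2 : ℝ) ≤ A := by exact_mod_cast hA2
      have hPy : psiTot X * Real.exp (-LA) = δ / (T * A * w) := by
        rw [hyA]; field_simp
      have hTAw : 2 * (T : ℝ) ≤ T * A * w := by
        have h1 : (T : ℝ) * 2 ≤ T * A := by gcongr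
        have h2 : (T : ℝ) * A * 1 ≤ T * A * w := by gcongr
        linarith
      simp only [hA2, true_and]
      refine (hP.measure_heavy_deviation (L := LA) ?_).trans ?_
      · rw [hPy, div_le_one (by positivity)]
        linarith
      · rw [hPy, ← mul_assoc, mul_div_assoc', div_le_iff₀ (by positivity)]
        nlinarith
    · simp only [hA2, false_and, Set.ofPred_false, measureReal_empty]
      exact hδ.le
  -- The shares of the five bad events are `2/3`, `1/9`, `1`, `1` and `1/9` of `δ`, in total less
  -- than `3 * δ`.
  refine (measureReal_mono (fun ω hω => ?_)).trans ((measureReal_union_le _ _).trans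
    (add_le_add (hR.trans hR') ((measureReal_union_le _ _).trans (add_le_add (hC.trans hC')
      ((measureReal_union_le _ _).trans (add_le_add (hB.trans hB')
        ((measureReal_union_le _ _).trans (add_le_add hH (hZ.trans hZ')))))))) |>.trans ?_)
  swap
  · linarith
  by_contra hnot
  simp only [Set.mem_union, not_or] at hnot
  obtain ⟨nR, nC, nB, nH, nZ⟩ := hnot
  refine hω ⟨fun t ht => ⟨fun a ψ => ?_, fun i => ?_, fun I B n hn h1 => ?_,
    fun hA2 I B n hn h1 hB hc => ?_⟩, not_le.1 nZ⟩
  · by_contra hlt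
    exact nR ⟨t, Finset.mem_range.2 ht, (a, ψ), not_le.1 hlt⟩
  · by_contra hlt
    exact nC ⟨t, Finset.mem_range.2 ht, i, not_le.1 hlt⟩
  all_goals
    have hnT : n ≤ T := by
      rw [hn]
      refine (Finset.card_filter_le _ _).trans ?_
      rw [Finset.card_range]
      exact ht.le
    by_contra hlt
  · exact nB ⟨n, Finset.mem_Icc.2 ⟨h1, hnT⟩, ⟨I, B⟩, t, ht.le, hn.symm, (not_le.1 hlt).le⟩
  · exact nH ⟨hA2, n, Finset.mem_Icc.2 ⟨h1, hnT⟩, ⟨I, B⟩, ⟨hB, hc⟩, t, ht.le, hn.symm,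
      (not_le.1 hlt).le⟩

/-- The bracket in the regret bound for a general window. -/
def windowBound (A : ℕ) {D : ℕ} (X : Fin D → Type*) [∀ i, Fintype (X i)] (T w : ℕ) (δ : ℝ) : ℝ :=
  T * (√(A * psiTot X * Real.log (T * A * psiTot X * w / δ) / w)
      + D * √(Real.log (T * D * w / δ) / w))
    + √(T * Real.log (1 / δ)) * (√(A * psiTot X * Real.log (T * A * psiTot X * w / δ))
      + D * √(Real.log (T * D * w / δ)))
    + √(T * numObs D * psiTot X * Real.log (T * numObs D / δ))

lemma regret_le_windowBound {ω : Ω} (hA : 1 ≤ A) (hP : P.IsInteraction μ 𝓕 env T)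
    (hs : env.numChanges T = 0) (hT : 1 ≤ T) (hw : 1 ≤ w) (hδ : 0 < δ) (hδ' : δ < 1 / 3)
    (halg : P.FollowsNCCUCRL2 T w δ) (hacc : ∀ t < T, Accurate P env T w δ t ω)
    (hpol : ∑ t ∈ Finset.range T, ((∑ ψ : PartialOn X (P.obs t ω),
          env.prob ψ.1 * (P.record ω).radAct T w δ t (P.strat t ω ψ.1) ψ.1) -
        (P.record ω).radAct T w δ t (P.act t ω) (P.pstate t ω)) <
      T * √(2 * Real.log (1 / δ) / T)) :
    P.regret env T ω ≤ 24 * windowBound A X T w δ := by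
  have hT1 : (1 : ℝ) ≤ T := by exact_mod_cast hT
  have hw1 : (1 : ℝ) ≤ w := by exact_mod_cast hw
  have hA1 : (1 : ℝ) ≤ A := by exact_mod_cast hA
  have hP1 : (1 : ℝ) ≤ psiTot X := by exact_mod_cast one_le_psiTot
  have hN1 : (1 : ℝ) ≤ numObs D := by exact_mod_cast one_le_numObs
  have hAP : 1 ≤ (A : ℝ) * psiTot X := one_le_mul_of_one_le_of_one_le hA1 hP1
  have hTN : 1 ≤ (T : ℝ) * numObs D := one_le_mul_of_one_le_of_one_le hT1 hN1
  have hL : 1 ≤ Real.log ((T : ℝ) * A * psiTot X * w / δ) := one_le_log_div hδ hδ'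
    (one_le_mul_of_one_le_of_one_le (one_le_mul_of_one_le_of_one_le
      (one_le_mul_of_one_le_of_one_le hT1 hA1) hP1) hw1)
  have hL' : 1 ≤ Real.log (2 * (T : ℝ) * numObs D / δ) := one_le_log_div hδ hδ' (by linarith)
  have hl := one_le_log_div hδ hδ' le_rfl
  have hround := Finset.sum_le_sum fun t (ht : t ∈ Finset.range T) =>
    (hacc t (Finset.mem_range.1 ht)).regret_round_le hA hP hs (Finset.mem_range.1 ht) halg hL hL'
  rw [Finset.sum_add_distrib, Finset.sum_add_distrib, ← Finset.mul_sum, ← Finset.mul_sum,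
    ← Finset.mul_sum] at hround
  rw [Finset.sum_sub_distrib] at hpol
  have hobs := (P.record ω).sum_radObs_le T δ
  have hact := (P.record ω).sum_radAct_le T δ hw
  have hfeat := (P.record ω).sum_radFeature_le T δ hw
  simp only [Play.record_obs, Play.record_act, Play.record_pstate] at hobs hact hfeat
  set a := √(A * psiTot X * Real.log ((T : ℝ) * A * psiTot X * w / δ)) with ha
  set b := √(Real.log ((T : ℝ) * D * w / δ)) with hb
  set l := √(Real.log (1 / δ)) with hl_def
  set g := √(T * numObs D * psiTot X * Real.log (T * numObs D / δ)) with hg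
  have ha1 : 1 ≤ a := by
    rw [ha, Real.one_le_sqrt]
    exact one_le_mul_of_one_le_of_one_le hAP hL
  have hb0 : 0 ≤ b := Real.sqrt_nonneg _
  have hl1 : 1 ≤ l := Real.one_le_sqrt.2 hl
  have hT0 : 0 ≤ √(T : ℝ) := Real.sqrt_nonneg _
  have hw0 : 0 < √(w : ℝ) := Real.sqrt_pos.2 (by linarith)
  have hsq2 : √(2 : ℝ) ≤ 2 := by
    rw [Real.sqrt_le_left (by norm_num)]; norm_num
  have hobs' : √(2 * psiTot X * Real.log (2 * (T : ℝ) * numObs D / δ)) * (3 * √(numObs D * T)) ≤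
      6 * g := by
    have hlog : Real.log (2 * (T : ℝ) * numObs D / δ) ≤ 2 * Real.log (T * numObs D / δ) := by
      rw [mul_assoc, mul_div_assoc, Real.log_mul two_ne_zero (by positivity), two_mul]
      refine add_le_add_left (Real.log_le_log two_pos ?_) _
      rw [le_div_iff₀ hδ]
      linarith
    have : √(2 * psiTot X * Real.log (2 * (T : ℝ) * numObs D / δ)) * √(numObs D * T) ≤ 2 * g := by
      rw [← Real.sqrt_mul (by positivity), Real.sqrt_le_left (by positivity), mul_pow,
        Real.sq_sqrt (mul_nonneg (by positivity) (zero_le_one.trans (one_le_log_div hδ hδ' hTN)))]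
      calc _ = (2 * psiTot X * numObs D * T) * Real.log (2 * (T : ℝ) * numObs D / δ) := by ring
        _ ≤ (2 * psiTot X * numObs D * T) * (2 * Real.log (T * numObs D / δ)) :=
            mul_le_mul_of_nonneg_left hlog (by positivity)
        _ = _ := by ring
    linarith
  have hpol' : T * √(2 * Real.log (1 / δ) / T) ≤ 2 * (√T * l) := by
    rw [Real.sqrt_div' _ (by positivity), Real.sqrt_mul (by norm_num), mul_div_assoc',
      mul_comm, mul_div_assoc, Real.div_sqrt]
    calc √2 * l * √T ≤ 2 * l * √T := by gcongr
      _ = 2 * (√T * l) := by ring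
  have hfeat' : 3 * (D * √(2 * Real.log ((T : ℝ) * D * w / δ))) * (T / √w + √T) ≤
      6 * (D * b) * (T / √w + √T) := by
    rw [Real.sqrt_mul (by norm_num)]
    have : D * (√2 * b) ≤ D * (2 * b) := by gcongr
    have h2 : 0 ≤ T / √(w : ℝ) + √T := by positivity
    nlinarith [mul_le_mul_of_nonneg_right this h2]
  have hwin : windowBound A X T w δ = T / √w * (a + D * b) + √T * l * (a + D * b) + g := by
    rw [windowBound, Real.sqrt_div' _ (Nat.cast_nonneg w), Real.sqrt_div' _ (Nat.cast_nonneg w),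
      Real.sqrt_mul (Nat.cast_nonneg T)]
    ring
  rw [Play.regret, hwin]
  -- The remainders `√T * a` and `√T * (D * b)` from the last block are absorbed using `1 ≤ l`, and
  -- the martingale term `√T * l` using `1 ≤ a`. The constant `24 = 4 * 6` comes from the law radii.
  have h1 : 0 ≤ √(T : ℝ) * (l - 1) * a := by
    have : 0 ≤ l - 1 := by linarith
    positivity
  have h2 : 0 ≤ √(T : ℝ) * (l - 1) * (D * b) := by
    have : 0 ≤ l - 1 := by linarith
    positivity
  have h3 : 0 ≤ √(T : ℝ) * l * (a - 1) := by
    have : 0 ≤ a - 1 := by linarith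
    positivity
  have h4 : 0 ≤ T / √(w : ℝ) * a := by positivity
  have h5 : 0 ≤ T / √(w : ℝ) * (D * b) := by positivity
  have h6 : 0 ≤ √(T : ℝ) * l * a := by positivity
  have h7 : 0 ≤ √(T : ℝ) * l * (D * b) := by positivity
  linarith

lemma windowBound_nonneg : 0 ≤ windowBound A X T w δ := by
  rw [windowBound]
  positivity

lemma windowBound_self_le (hA : 1 ≤ A) (hT : 1 ≤ T) (hδ : 0 < δ) (hδ' : δ < 1 / 3) :
    windowBound A X T T δ ≤ 2 * ((1 + √(Real.log (1 / δ))) *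
        (√(T * A * psiTot X * Real.log (T * A * psiTot X / δ)) + D * √(T * Real.log (T * D / δ)))
      + √(T * numObs D * psiTot X * Real.log (T * numObs D / δ))) := by
  have hT1 : (1 : ℝ) ≤ T := by exact_mod_cast hT
  have hA1 : (1 : ℝ) ≤ A := by exact_mod_cast hA
  have hP1 : (1 : ℝ) ≤ psiTot X := by exact_mod_cast one_le_psiTot
  -- The extra factor `T` in the logarithm is at most `c`, hence at most `c / δ`.
  have hlog {c : ℝ} (hc : (T : ℝ) ≤ c) : Real.log (c * T / δ) ≤ 2 * Real.log (c / δ) := by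
    have hc0 : 0 < c := by linarith
    rw [mul_div_right_comm, Real.log_mul (by positivity) (by positivity), two_mul]
    refine add_le_add_right (Real.log_le_log (by positivity) ?_) _
    rw [le_div_iff₀ hδ]
    nlinarith
  have hsqrt {x y : ℝ} (h : x ≤ 2 * y) : √x ≤ 2 * √y := by
    rcases le_or_gt x 0 with hx | hx
    · rw [Real.sqrt_eq_zero_of_nonpos hx]; positivity
    · rw [Real.sqrt_le_left (by positivity), mul_pow, Real.sq_sqrt (by linarith)]
      linarith
  have hscale (x : ℝ) : T * √(x / T) = √(T * x) := by
    rw [Real.sqrt_div' _ (Nat.cast_nonneg T), mul_div_assoc', mul_comm, mul_div_assoc,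
      Real.div_sqrt, Real.sqrt_mul (Nat.cast_nonneg T), mul_comm]
  have ha : √(T * (A * psiTot X * Real.log (T * A * psiTot X * T / δ))) ≤
      2 * √(T * A * psiTot X * Real.log (T * A * psiTot X / δ)) := by
    refine hsqrt ?_
    have hAP : 1 ≤ (A : ℝ) * psiTot X := one_le_mul_of_one_le_of_one_le hA1 hP1
    have := hlog (c := T * A * psiTot X) (by rw [mul_assoc]; nlinarith)
    calc _ = (T * A * psiTot X) * Real.log (T * A * psiTot X * T / δ) := by ring
      _ ≤ (T * A * psiTot X) * (2 * Real.log (T * A * psiTot X / δ)) :=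
          mul_le_mul_of_nonneg_left this (by positivity)
      _ = _ := by ring
  have hb : D * √(T * Real.log (T * D * T / δ)) ≤ 2 * (D * √(T * Real.log (T * D / δ))) := by
    rcases Nat.eq_zero_or_pos D with h0 | hD
    · simp [h0]
    have hD1 : (1 : ℝ) ≤ D := by exact_mod_cast hD
    have h1 : √(T * Real.log (T * D * T / δ)) ≤ 2 * √(T * Real.log (T * D / δ)) := by
      refine hsqrt ?_
      have := mul_le_mul_of_nonneg_left (hlog (c := T * D) (by nlinarith)) (Nat.cast_nonneg T)
      linarith
    have := mul_le_mul_of_nonneg_left h1 (Nat.cast_nonneg (α := ℝ) D)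
    linarith
  rw [Real.sqrt_mul (Nat.cast_nonneg T)] at ha hb
  set l := √(Real.log (1 / δ))
  have hl : 0 ≤ l := Real.sqrt_nonneg _
  have key : windowBound A X T T δ = (1 + l) *
      (√T * √(A * psiTot X * Real.log (T * A * psiTot X * T / δ)) +
        D * (√T * √(Real.log (T * D * T / δ)))) +
      √(T * numObs D * psiTot X * Real.log (T * numObs D / δ)) := by
    rw [windowBound, mul_add (T : ℝ), mul_left_comm (T : ℝ), hscale, hscale,
      Real.sqrt_mul (Nat.cast_nonneg T), Real.sqrt_mul (Nat.cast_nonneg T),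
      Real.sqrt_mul (Nat.cast_nonneg T) (Real.log (1 / δ))]
    ring
  rw [key]
  have h1 := mul_le_mul_of_nonneg_left (add_le_add ha hb) (by linarith : 0 ≤ 1 + l)
  have h2 := Real.sqrt_nonneg (T * numObs D * psiTot X * Real.log (T * numObs D / δ))
  linarith

lemma measure_regret_le (hA : 1 ≤ A) (hP : P.IsInteraction μ 𝓕 env T)
    (hs : env.numChanges T = 0) (hT : 1 ≤ T) (hw : 1 ≤ w) (hδ : 0 < δ) (hδ' : δ < 1 / 3)
    (halg : P.FollowsNCCUCRL2 T w δ) {b : ℝ} (hb : 24 * windowBound A X T w δ ≤ b) :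
    1 - 3 * δ ≤ μ.real {ω | P.regret env T ω ≤ b} := by
  have h1 := measure_not_accurate_le (w := w) hA hP hs hT hw hδ hδ'
  -- Subadditivity is used instead of complements, so the measurability of the events plays no role.
  have h2 : (1 : ℝ) ≤ μ.real {ω | P.regret env T ω ≤ b} + 3 * δ := by
    rw [← probReal_univ (μ := μ)]
    refine (measureReal_mono fun ω _ => ?_).trans ((measureReal_union_le _ _).trans
      (add_le_add le_rfl h1))
    by_contra hnot
    rw [Set.mem_union, not_or] at hnot
    obtain ⟨hacc, hpol⟩ := not_not.1 hnot.2
    exact hnot.1 ((regret_le_windowBound hA hP hs hT hw hδ hδ' halg hacc hpol).trans hb)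
  linarith

end Regret

end NCC

end

theorem theorem1 :
    ∃ K : ℝ, 0 < K ∧
      ∀ {A D : ℕ} (_ : 1 ≤ A) {X : Fin D → Type*} [∀ i, Fintype (X i)]
        {Ω : Type*} [mΩ : MeasurableSpace Ω] (μ : Measure Ω) [IsProbabilityMeasure μ]
        (𝓕 : Filtration ℕ mΩ) (env : NCC.Environment A X) (P : NCC.Play Ω A X)
        (T : ℕ) (δ : ℝ) (_ : 1 ≤ T) (_ : 0 < δ)
        (_ : P.IsInteraction μ 𝓕 env T) (_ : env.numChanges T = 0),
        (∀ w : ℕ, 1 ≤ w → P.FollowsNCCUCRL2 T w δ →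
          1 - 3 * δ ≤ μ.real {ω | P.regret env T ω ≤
            K * (T * (√(A * NCC.psiTot X * Real.log (T * A * NCC.psiTot X * w / δ) / w)
                    + D * √(Real.log (T * D * w / δ) / w))
                + √(T * Real.log (1 / δ)) *
                    (√(A * NCC.psiTot X * Real.log (T * A * NCC.psiTot X * w / δ))
                      + D * √(Real.log (T * D * w / δ)))
                + √(T * NCC.numObs D * NCC.psiTot X * Real.log (T * NCC.numObs D / δ)))}) ∧
        (P.FollowsNCCUCRL2 T T δ →
          1 - 3 * δ ≤ μ.real {ω | P.regret env T ω ≤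
            K * ((1 + √(Real.log (1 / δ))) *
                    (√(T * A * NCC.psiTot X * Real.log (T * A * NCC.psiTot X / δ))
                      + D * √(T * Real.log (T * D / δ)))
                + √(T * NCC.numObs D * NCC.psiTot X * Real.log (T * NCC.numObs D / δ)))}) := by
  -- The constant is `24` times the factor `2` lost on the logarithms when `w = T`.
  refine ⟨48, by norm_num, fun {A D} hA {X} _ {Ω} mΩ μ _ 𝓕 env P T δ hT hδ hP hs => ?_⟩
  rcases le_or_gt (1 / 3) δ with hδ' | hδ'
  -- Here `1 - 3 * δ ≤ 0`.
  · exact ⟨fun _ _ _ => le_trans (by linarith) measureReal_nonneg,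
      fun _ => le_trans (by linarith) measureReal_nonneg⟩
  · refine ⟨fun w hw halg => NCC.measure_regret_le hA hP hs hT hw hδ hδ' halg ?_,
      fun halg => NCC.measure_regret_le hA hP hs hT hT hδ hδ' halg ?_⟩
    · exact mul_le_mul_of_nonneg_right (by norm_num)
        (NCC.windowBound_nonneg (A := A) (X := X) (T := T) (w := w) (δ := δ))
    · linarith [NCC.windowBound_self_le (A := A) (X := X) hA hT hδ hδ']
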